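/- **Model.** A user hovers at height $h_U$ above the origin. Terrestrial base stations (BSs) at height $h_T<h_U$ form a homogeneous Poisson point process of density $\lambda_T>0$ in the plane. A terrestrial BS at horizontal distance $z$ has a line-of-sight link to the user (tier $\mathrm L$) with probability $P_L(z)=-a\,e^{-b\arctan(h_{UT}/z)}+c$ (cut off to $[0,1]$), where $h_{UT}=h_U-h_T$, and otherwise belongs to tier $\mathrm N$; these choices are independent. In addition $N\ge 1$ aerial BSs (tier $\mathrm A$) at height $h_A>h_U$ have independent horizontal positions that are uniform on the disc of radius $r_D$ around the origin. Put $h_{UA}=h_A-h_U$ and $d=\sqrt{r_D^2+h_{UA}^2}$. The fading gains are independent of each other and of everything else and $\mathrm{Gamma}(m_\nu,1/m_\nu)$-distributed (shape, scale) in tier $\nu\in\{\mathrm L,\mathrm N,\mathrm A\}$. Let $\mu_\nu=P_T\eta_\nu g_s^{T}$ for $\nu\in\{\mathrm L,\mathrm N\}$ and $\mu_A=P_AG_m^{A}\eta_A$; transmit powers, losses, gains, path-loss exponents $\alpha_\nu$ and fading parameters $m_\nu$ are positive. The serving BS $x_0$ is the one with the largest average received power $\mu_\nu r^{-\alpha_\nu}$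 ($\nu$ its tier, $r$ its distance to the user); $\mathcal E_\nu$ is the event that it belongs to tier $\nu$, and $\tilde R_\nu$ is its distance on this event. An interfering terrestrial BS of tier $\nu$ at distance $r$ with fading $H$ contributes $\mu_\nu H r^{-\alpha_\nu}$, and an interfering aerial BS contributes $P_A G\eta_A H r^{-\alpha_A}$, where $G=G_m^A$ with probability $q_A=\theta_B^A/180$ (beamwidth $\theta_B^A\in[0,180]$) and $G=g_s^A$ otherwise, independently of everything else. Let $I_L,I_N,I_A\in[0,\infty]$ be the sums of these contributions over all BSs of the respective tier other than $x_0$. Under non-orthogonal sharing $I=I_L+I_N+I_A$; under orthogonal sharing $I=I_L+I_N$ if $x_0$ is terrestrial and $I=I_A$ if $x_0$ is aerial. With noise power $\sigma^2>0$ and $V=I+\sigma^2$, on $\mathcal E_\nu$ the SINR is $\gamma=\mu_\nu H^{x_0}\tilde R_\nu^{-\alpha_\nu}/V$. **Theorem.** Take either sharing policy and a tier $\nu$ for which $m_\nu$ is a positive integer and $\mathbb P(\mathcal E_\nu)>0$. Conditional on $\mathcal E_\nu$, the distance $\tilde R_\nu$ has a Lebesgue density $f_{\tilde R_\nu|\mathcal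 E_\nu}$. Let $$\mathcal L_{V|\mathcal E_\nu}(s)=e^{-\sigma^2 s}\,\mathbb E\bigl[e^{-sI}\,\big|\,\mathcal E_\nu,\tilde R_\nu=r\bigr]$$ be the Laplace transform of $V=I+\sigma^2$ conditional on $\mathcal E_\nu$ and on the serving distance $r$ (with $e^{-s\infty}=0$), which is smooth in $s>0$. Then the average achievable rate $\mathcal R_\nu=\mathbb E[\log_2(1+\gamma)\mid\mathcal E_\nu]$ is finite and $$\mathcal R_\nu=\sum_{k=0}^{m_\nu-1}\frac{(-1)^k}{\ln(2)\,k!}\Bigl(\frac{m_\nu}{\mu_\nu}\Bigr)^k\int_0^\infty\!\int_{\mathfrak R_\nu} r^{k\alpha_\nu}(e^t-1)^k\Bigl[\frac{\partial^k}{\partial s^k}\mathcal L_{V|\mathcal E_\nu}(s)\Bigr]_{s=\frac{m_\nu(e^t-1)r^{\alpha_\nu}}{\mu_\nu}} f_{\tilde R_\nu|\mathcal E_\nu}(r)\,dr\,dt ,$$ where all the double integrals converge absolutely, $\mathfrak R_A=[h_{UA},d]$ and $\mathfrak R_\nu=\bigl[h_{UT},(\mu_\nu d^{\alpha_A}/\mu_A)^{1/\alpha_\nu}\bigr]$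 for $\nu\in\{\mathrm L,\mathrm N\}$. The same holds with $\mathfrak R_\nu$ replaced by any larger measurable set, for instance with $[h_{UT},d]$ for $\nu=\mathrm N$ if $\mu_N d^{\alpha_A}\le\mu_A d^{\alpha_N}$. -/

import Mathlib

open MeasureTheory ProbabilityTheory Set
open scoped ENNReal Nat

noncomputable section

/-- The three tiers of base stations (BSs): line-of-sight terrestrial, non-line-of-sight
terrestrial, aerial. -/
inductive Tier where
  | L
  | N
  | A

/-- The two spectrum sharing policies between aerial and terrestrial BSs:
non-orthogonal and orthogonal. -/
inductive Policy where
  | NOSS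
  | OSS

/-- The horizontal plane. -/
abbrev Plane : Type := EuclideanSpace ℝ (Fin 2)

/-- The parameters of the network. -/
structure VHetNet where
  /-- density of the terrestrial BSs -/
  lam : ℝ
  /-- number of aerial BSs -/
  N : ℕ
  /-- radius of the disc over which the aerial BSs are distributed -/
  rD : ℝ
  /-- height of the terrestrial BSs -/
  hT : ℝ
  /-- height of the user -/
  hU : ℝ
  /-- height of the aerial BSs -/
  hA : ℝ
  /-- transmit power of the terrestrial BSs -/
  PT : ℝ
  /-- transmit power of the aerial BSs -/
  PA : ℝ
  /-- excess losses of the links of each tier -/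
  eta : Tier → ℝ
  /-- path-loss exponents -/
  alpha : Tier → ℝ
  /-- Nakagami fading parameters -/
  m : Tier → ℝ
  /-- sidelobe gain of the terrestrial antennas -/
  gsT : ℝ
  /-- mainlobe gain of the aerial antennas -/
  GmA : ℝ
  /-- sidelobe gain of the aerial antennas -/
  gsA : ℝ
  /-- beamwidth of the aerial antennas, in degrees -/
  thetaB : ℝ
  /-- noise power `σ²` -/
  noise : ℝ
  /-- coefficients of the line-of-sight probability -/
  a : ℝ
  b : ℝ
  c : ℝ
  lam_pos : 0 < lam
  N_pos : 0 < N
  rD_pos : 0 < rD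
  hT_lt_hU : hT < hU
  hU_lt_hA : hU < hA
  PT_pos : 0 < PT
  PA_pos : 0 < PA
  eta_pos : ∀ ν, 0 < eta ν
  alpha_pos : ∀ ν, 0 < alpha ν
  m_pos : ∀ ν, 0 < m ν
  gsT_pos : 0 < gsT
  GmA_pos : 0 < GmA
  gsA_pos : 0 < gsA
  thetaB_mem : thetaB ∈ Set.Icc (0 : ℝ) 180
  noise_pos : 0 < noise

namespace VHetNet

variable (net : VHetNet)

/-- Height of the user relative to the terrestrial BSs. -/
def hUT : ℝ := net.hU - net.hT

/-- Height difference between the aerial BSs and the user. -/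
def hUA : ℝ := net.hA - net.hU

/-- The largest possible distance of an aerial BS to the user. -/
def d : ℝ := Real.sqrt (net.rD ^ 2 + net.hUA ^ 2)

/-- The factors `μ_ν` of the average received powers `μ_ν r ^ (-α_ν)`. -/
def mu : Tier → ℝ
  | .L => net.PT * net.eta .L * net.gsT
  | .N => net.PT * net.eta .N * net.gsT
  | .A => net.PA * net.GmA * net.eta .A

/-- The probability of a line of sight to a terrestrial BS at horizontal distance `z > 0`
(to be read as `0` or `1` where the fitted coefficients take it outside `[0, 1]`; the unit of the
angle is absorbed in `b`). -/
def PL (z : ℝ) : ℝ := -net.a * Real.exp (-net.b * Real.arctan (net.hUT / z)) + net.c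

/-- The probability that an interfering aerial BS points its mainlobe at the user. -/
def qA : ℝ := net.thetaB / 180

/-- The law of the antenna gain of an interfering aerial BS. -/
def gainLaw : Measure ℝ :=
  ENNReal.ofReal net.qA • Measure.dirac net.GmA
    + ENNReal.ofReal (1 - net.qA) • Measure.dirac net.gsA

/-- The distance at which a terrestrial BS of tier `ν` has the average received power of an
aerial BS at distance `x`. -/
def zetaA (ν : Tier) (x : ℝ) : ℝ :=
  (net.mu ν * x ^ net.alpha .A / net.mu .A) ^ (1 / net.alpha ν)

/-- The range of the distance to the serving BS when it belongs to tier `ν`. -/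
def distRange : Tier → Set ℝ
  | .L => Set.Icc net.hUT (net.zetaA .L net.d)
  | .N => Set.Icc net.hUT (net.zetaA .N net.d)
  | .A => Set.Icc net.hUA net.d

end VHetNet

/-- The number of the points `X 0, X 1, …` that lie in `B`. -/
def pointCount {Ω E : Type*} (X : ℕ → Ω → E) (B : Set E) (ω : Ω) : ℕ∞ :=
  Set.encard {j | X j ω ∈ B}

/-- The random points `X 0, X 1, …` (listed with multiplicity, in some order) form a Poisson point
process with intensity measure `Λ`. -/
structure IsPoissonPP {Ω E : Type*} [MeasurableSpace Ω] [MeasurableSpace E]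
    (X : ℕ → Ω → E) (Λ : Measure E) (P : Measure Ω) : Prop where
  measurable : ∀ j, Measurable (X j)
  poisson : ∀ B : Set E, MeasurableSet B → Λ B ≠ ∞ → ∀ n : ℕ,
    P {ω | pointCount X B ω = n} =
      ENNReal.ofReal (Real.exp (-(Λ B).toReal) * (Λ B).toReal ^ n / n !)
  indep : ∀ (n : ℕ) (B : Fin n → Set E), (∀ i, MeasurableSet (B i)) → (∀ i, Λ (B i) ≠ ∞) →
    Pairwise (fun i j => Disjoint (B i) (B j)) →
    iIndepFun (fun i => pointCount X (B i)) P

/-- A realization of the network on a probability space. The user is above the origin. -/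
structure VHetNet.Model (net : VHetNet) {Ω : Type*} [MeasurableSpace Ω] (P : Measure Ω) where
  /-- horizontal positions of the terrestrial BSs -/
  X : ℕ → Ω → Plane
  /-- uniform marks that decide whether the links to the terrestrial BSs have a line of sight -/
  U : ℕ → Ω → ℝ
  /-- fading gain of a terrestrial BS if its link has a line of sight -/
  HL : ℕ → Ω → ℝ
  /-- fading gain of a terrestrial BS if its link has no line of sight -/
  HN : ℕ → Ω → ℝ
  /-- horizontal positions of the aerial BSs -/
  Y : Fin net.N → Ω → Plane
  /-- antenna gains of the aerial BSs when they interfere -/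
  G : Fin net.N → Ω → ℝ
  /-- fading gains of the aerial BSs -/
  HA : Fin net.N → Ω → ℝ
  poisson : IsPoissonPP X (ENNReal.ofReal net.lam • (volume : Measure Plane)) P
  measurable_U : ∀ j, Measurable (U j)
  measurable_HL : ∀ j, Measurable (HL j)
  measurable_HN : ∀ j, Measurable (HN j)
  measurable_Y : ∀ i, Measurable (Y i)
  measurable_G : ∀ i, Measurable (G i)
  measurable_HA : ∀ i, Measurable (HA i)
  law_terr : ∀ j, P.map (fun ω => (U j ω, HL j ω, HN j ω)) =
    (volume.restrict (Set.Icc (0 : ℝ) 1)).prod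
      ((gammaMeasure (net.m .L) (net.m .L)).prod (gammaMeasure (net.m .N) (net.m .N)))
  law_aer : ∀ i, P.map (fun ω => (Y i ω, G i ω, HA i ω)) =
    (ProbabilityTheory.cond (volume : Measure Plane) (Metric.closedBall 0 net.rD)).prod
      (net.gainLaw.prod (gammaMeasure (net.m .A) (net.m .A)))
  indep_terr : iIndepFun (fun j ω => (U j ω, HL j ω, HN j ω)) P
  indep_aer : iIndepFun (fun i ω => (Y i ω, G i ω, HA i ω)) P
  indep_marks : IndepFun (fun ω j => X j ω) (fun ω j => (U j ω, HL j ω, HN j ω)) P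
  indep_tiers : IndepFun (fun ω => ((fun j => X j ω), (fun j => (U j ω, HL j ω, HN j ω))))
    (fun ω i => (Y i ω, G i ω, HA i ω)) P

namespace VHetNet.Model

variable {net : VHetNet} {Ω : Type*} [MeasurableSpace Ω] {P : Measure Ω} (M : net.Model P)

open Classical in
/-- The tier of a BS. A terrestrial BS (`Sum.inl`) at horizontal distance `z` has a line of sight
with probability `P_L(z)`, independently of all others. -/
def tier (ω : Ω) : ℕ ⊕ Fin net.N → Tier
  | .inl j => if M.U j ω ≤ net.PL ‖M.X j ω‖ then .L else .N
  | .inr _ => .A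

/-- The distance between the user and a BS. -/
def dist (ω : Ω) : ℕ ⊕ Fin net.N → ℝ
  | .inl j => Real.sqrt (‖M.X j ω‖ ^ 2 + net.hUT ^ 2)
  | .inr i => Real.sqrt (‖M.Y i ω‖ ^ 2 + net.hUA ^ 2)

/-- The fading gain of a BS. -/
def fading (ω : Ω) : ℕ ⊕ Fin net.N → ℝ
  | .inl j => match M.tier ω (.inl j) with
    | .L => M.HL j ω
    | _ => M.HN j ω
  | .inr i => M.HA i ω

/-- The long-term averaged power received from a BS if it serves the user. -/
def avgPower (ω : Ω) (x : ℕ ⊕ Fin net.N) : ℝ :=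
  net.mu (M.tier ω x) * M.dist ω x ^ (-net.alpha (M.tier ω x))

/-- The power received from a BS if it interferes. -/
def interfPower (ω : Ω) : ℕ ⊕ Fin net.N → ℝ
  | .inl j => net.mu (M.tier ω (.inl j)) * M.fading ω (.inl j)
      * M.dist ω (.inl j) ^ (-net.alpha (M.tier ω (.inl j)))
  | .inr i => net.PA * M.G i ω * net.eta .A * M.HA i ω * M.dist ω (.inr i) ^ (-net.alpha .A)

/-- `x` provides the strongest long-term averaged received power (ties have probability zero). -/
def IsServing (ω : Ω) (x : ℕ ⊕ Fin net.N) : Prop :=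
  ∀ y, y ≠ x → M.avgPower ω y < M.avgPower ω x

/-- The serving BS `x₀`. -/
def serving (ω : Ω) : ℕ ⊕ Fin net.N := Classical.epsilon (M.IsServing ω)

/-- The event `E_ν` that the user is served by a BS of tier `ν`. -/
def assoc (ν : Tier) : Set Ω := {ω | M.IsServing ω (M.serving ω) ∧ M.tier ω (M.serving ω) = ν}

/-- The distance between the user and the serving BS. -/
def servDist (ω : Ω) : ℝ := M.dist ω (M.serving ω)

/-- The interference power from the BSs of tier `τ`. -/
def tierInterf (τ : Tier) (ω : Ω) : ℝ≥0∞ :=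
  ∑' x : {x : ℕ ⊕ Fin net.N // x ≠ M.serving ω ∧ M.tier ω x = τ},
    ENNReal.ofReal (M.interfPower ω x)

/-- The aggregate interference power `I`. -/
def interf (pol : Policy) (ω : Ω) : ℝ≥0∞ :=
  match pol, M.tier ω (M.serving ω) with
  | .NOSS, _ => M.tierInterf .L ω + M.tierInterf .N ω + M.tierInterf .A ω
  | .OSS, .A => M.tierInterf .A ω
  | .OSS, _ => M.tierInterf .L ω + M.tierInterf .N ω

/-- The signal-to-interference-and-noise ratio `γ`; it is `0` where `I = ∞`. -/
def sinr (pol : Policy) (ω : Ω) : ℝ :=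
  (ENNReal.ofReal (M.avgPower ω (M.serving ω) * M.fading ω (M.serving ω)) /
    (M.interf pol ω + ENNReal.ofReal net.noise)).toReal

/-- The average achievable rate `R_ν` when the user is associated with tier `ν`. -/
def rate (pol : Policy) (ν : Tier) : ℝ :=
  ∫ ω, Real.logb 2 (1 + M.sinr pol ω) ∂(ProbabilityTheory.cond P (M.assoc ν))

/-- The density of the distance to the serving BS, conditional on `E_ν`. -/
def servDistPdf (ν : Tier) (r : ℝ) : ℝ :=
  (pdf M.servDist (ProbabilityTheory.cond P (M.assoc ν)) volume r).toReal

open Classical in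
/-- The Laplace transform of `I` at `s`, conditional on `E_ν` and on the serving BS being at
distance `r` (with `exp (-s ∞) = 0`). -/
def laplaceI [IsProbabilityMeasure P] (pol : Policy) (ν : Tier) (r s : ℝ) : ℝ :=
  ∫ v : ℝ≥0∞, (if v = ∞ then 0 else Real.exp (-s * v.toReal))
    ∂(condDistrib (M.interf pol) M.servDist (ProbabilityTheory.cond P (M.assoc ν)) r)

/-- The Laplace transform of `V = I + σ²` at `s`, conditional on `E_ν` and on the serving BS being
at distance `r`. -/
def laplaceV [IsProbabilityMeasure P] (pol : Policy) (ν : Tier) (r s : ℝ) : ℝ :=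
  Real.exp (-net.noise * s) * M.laplaceI pol ν r s

end VHetNet.Model

end

/-!
Conditionally on `E_ν`, the fading gain `H` of the serving BS is `Gamma(m, 1/m)` distributed and
independent of the pair `(R, I)` of the serving distance and the interference
(`VHetNet.Model.map_servDist_interf_fading`). Indeed `E_ν` is the disjoint union, over all BSs
`x`, of the events that `x` serves and has tier `ν`; these events, the distance of `x` and the
interference of the BSs other than `x` do not involve the fading of `x`, so that they are
functions of the configuration with that fading erased (`VHetNet.Config.erase`), of which the
fading of `x` is independent (`VHetNet.Model.indepFun_gain_erase`). The distance has a density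
because each single distance is absolutely continuous: a Poisson process has no points in a null
set (`VHetNet.Model.hasPDF_servDist`).

The rest is a statement about three random variables (`rate_formula`). By the layer cake formula,
the expectation of `log (1 + γ)` is the integral over `t > 0` of
`ℙ(γ > e ^ t - 1) = ℙ(H > (e ^ t - 1) R ^ α V / μ)`, where `V = I + σ²`. For an integer `m` the Gamma tail at `y` is the Poisson sum
`∑_{k < m} (m y) ^ k / k! * e ^ (-m y)` (`gammaMeasure_Ioi`). Averaging `(s V) ^ k * e ^ (-s V)`
over the conditional law of `V` given `R = r` turns the weight at `k` into `s ^ k * (-1) ^ k`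
times the `k`-th derivative of the Laplace transform (`lintegral_poissonTerm`), which is a moment
generating function and hence smooth. All terms are nonnegative, so that Tonelli's theorem applies
in `[0, ∞]`, and absolute convergence follows from the finiteness of the rate, which the bound
`log (1 + γ) ≤ γ` gives (`lintegral_log_sinrOf_lt_top`). The domain of integration in `r` is
immaterial as long as it contains the range of `R`, since the density vanishes almost everywhere
elsewhere.
-/

noncomputable section

/-! ### Gamma distributions with integer shape -/

/-- The derivative of the Poisson sum telescopes to minus its last weight, which is minus a
Gamma density. -/
lemma hasDerivAt_erlangSum (n : ℕ) (x : ℝ) :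
    HasDerivAt (fun x : ℝ => ∑ k ∈ Finset.range (n + 1), x ^ k / k ! * Real.exp (-x))
      (-(x ^ n / n ! * Real.exp (-x))) x := by
  have hexp : HasDerivAt (fun x : ℝ => Real.exp (-x)) (-Real.exp (-x)) x := by
    simpa using (hasDerivAt_neg x).exp
  induction n with
  | zero => simpa using hexp
  | succ n ih =>
    simp_rw [Finset.sum_range_succ _ (n + 1)]
    have h1 : HasDerivAt (fun x : ℝ => x ^ (n + 1) / ((n + 1)! : ℝ) * Real.exp (-x))
        (((n + 1 : ℕ) : ℝ) * x ^ n / ((n + 1)! : ℝ) * Real.exp (-x)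
          + x ^ (n + 1) / ((n + 1)! : ℝ) * (-Real.exp (-x))) x := by
      exact ((hasDerivAt_pow (n + 1) x).div_const ((n + 1)! : ℝ)).mul hexp
    refine (ih.add h1).congr_deriv ?_
    have : (n ! : ℝ) ≠ 0 := by positivity
    have : ((n : ℝ) + 1) ≠ 0 := by positivity
    rw [Nat.factorial_succ]
    push_cast
    field_simp
    ring

lemma tendsto_erlangSum (n : ℕ) :
    Filter.Tendsto (fun x : ℝ => ∑ k ∈ Finset.range n, x ^ k / k ! * Real.exp (-x))
      Filter.atTop (nhds 0) := by
  rw [← Finset.sum_const_zero (s := Finset.range n) (M := ℝ)]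
  refine tendsto_finsetSum _ fun k _ => ?_
  have := (Real.tendsto_pow_mul_exp_neg_atTop_nhds_zero k).div_const (k ! : ℝ)
  simpa [div_mul_eq_mul_div] using this

/-- The tail of a Gamma distribution with integer shape is a Poisson sum: this is what produces the
finite sum over `k` and, after averaging, the derivatives of the Laplace transform. -/
lemma gammaMeasure_Ioi {n : ℕ} (hn : n ≠ 0) {l y : ℝ} (hl : 0 < l) (hy : 0 ≤ y) :
    gammaMeasure n l (Ioi y) =
      ENNReal.ofReal (∑ k ∈ Finset.range n, (l * y) ^ k / k ! * Real.exp (-(l * y))) := by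
  obtain ⟨p, rfl⟩ := Nat.exists_eq_succ_of_ne_zero hn
  have hder : ∀ x ∈ Ioi y, HasDerivAt
      (fun x : ℝ => -∑ k ∈ Finset.range (p + 1), (l * x) ^ k / k ! * Real.exp (-(l * x)))
      (gammaPDFReal (p + 1 : ℕ) l x) x := by
    intro x hx
    have hx0 : 0 < x := hy.trans_lt hx
    have h := ((hasDerivAt_erlangSum p (l * x)).comp x
      ((hasDerivAt_id x).const_mul l)).neg
    refine h.congr_deriv ?_
    rw [gammaPDFReal, if_pos hx0.le, Real.rpow_natCast]
    push_cast
    rw [Real.Gamma_nat_eq_factorial, add_sub_cancel_right, Real.rpow_natCast]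
    ring
  have hcont : ContinuousWithinAt
      (fun x : ℝ => -∑ k ∈ Finset.range (p + 1), (l * x) ^ k / k ! * Real.exp (-(l * x)))
      (Ici y) y := by
    apply Continuous.continuousWithinAt
    fun_prop
  have hnn : ∀ x ∈ Ioi y, 0 ≤ gammaPDFReal (p + 1 : ℕ) l x := fun x _ =>
    gammaPDFReal_nonneg (by positivity) hl x
  have hlim : Filter.Tendsto
      (fun x : ℝ => -∑ k ∈ Finset.range (p + 1), (l * x) ^ k / k ! * Real.exp (-(l * x)))
      Filter.atTop (nhds 0) := by
    simpa using ((tendsto_erlangSum (p + 1)).comp (Filter.tendsto_id.const_mul_atTop hl)).neg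
  have hint := integrableOn_Ioi_deriv_of_nonneg hcont hder hnn hlim
  have hval := integral_Ioi_of_hasDerivAt_of_nonneg hcont hder hnn hlim
  rw [gammaMeasure, withDensity_apply _ measurableSet_Ioi]
  simp only [gammaPDF]
  rw [← ofReal_integral_eq_lintegral_ofReal hint
    ((ae_restrict_iff' measurableSet_Ioi).2 (ae_of_all _ hnn)), hval]
  simp

/-- A Gamma distribution has a finite mean: `x` times its density is a multiple of the Gamma density
of shape `a + 1`. -/
lemma lintegral_gammaMeasure_lt_top {a l : ℝ} (ha : 0 < a) (hl : 0 < l) :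
    ∫⁻ x, ENNReal.ofReal x ∂(gammaMeasure a l) < ∞ := by
  have hpdf : Measurable (gammaPDF a l) := (measurable_gammaPDFReal a l).ennreal_ofReal
  rw [gammaMeasure, lintegral_withDensity_eq_lintegral_mul _
    hpdf (by fun_prop)]
  have : ∀ x, (gammaPDF a l * fun x => ENNReal.ofReal x) x
      ≤ ENNReal.ofReal (a / l) * gammaPDF (a + 1) l x := by
    intro x
    rcases lt_or_ge 0 x with hx | hx
    · simp only [Pi.mul_apply]
      rw [gammaPDF_of_nonneg hx.le, gammaPDF_of_nonneg hx.le,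
        ← ENNReal.ofReal_mul (by have := Real.Gamma_pos_of_pos ha; positivity),
        ← ENNReal.ofReal_mul (by positivity)]
      apply le_of_eq
      congr 1
      have := (Real.Gamma_pos_of_pos ha).ne'
      rw [Real.Gamma_add_one ha.ne', Real.rpow_add_one hl.ne', add_sub_cancel_right,
        Real.rpow_sub_one hx.ne']
      field_simp
    · simp [ENNReal.ofReal_of_nonpos hx]
  refine (lintegral_mono this).trans_lt ?_
  rw [lintegral_const_mul' _ _ ENNReal.ofReal_ne_top,
    lintegral_gammaPDF_eq_one (by positivity) hl, mul_one]
  exact ENNReal.ofReal_lt_top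

/-! ### Independence -/

section Independence

variable {Ω α β γ : Type*} [MeasurableSpace Ω] [MeasurableSpace α] [MeasurableSpace β]
  [MeasurableSpace γ] {P : Measure Ω}

/-- The contraction property of independence: if `f` is independent of `g` and the pair `(f, g)` of
`k`, then `f` is independent of the pair `(g, k)`. -/
lemma ProbabilityTheory.IndepFun.prodMk_of_prodMk [IsProbabilityMeasure P]
    {f : Ω → α} {g : Ω → β} {k : Ω → γ}
    (hf : Measurable f) (hg : Measurable g) (hk : Measurable k) (hfg : IndepFun f g P)
    (hfgk : IndepFun (fun ω => (f ω, g ω)) k P) : IndepFun f (fun ω => (g ω, k ω)) P := by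
  have : IsProbabilityMeasure (P.map f) := Measure.isProbabilityMeasure_map hf.aemeasurable
  have : IsProbabilityMeasure (P.map g) := Measure.isProbabilityMeasure_map hg.aemeasurable
  have : IsProbabilityMeasure (P.map k) := Measure.isProbabilityMeasure_map hk.aemeasurable
  have hgk : IndepFun g k P := hfgk.comp measurable_snd measurable_id
  have e1 := hfg.map_prod_eq_prod_map_map hf.aemeasurable hg.aemeasurable
  have e2 := hgk.map_prod_eq_prod_map_map hg.aemeasurable hk.aemeasurable
  have e3 := hfgk.map_prod_eq_prod_map_map (hf.prodMk hg).aemeasurable hk.aemeasurable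
  rw [indepFun_iff_map_prod_eq_prod_map_map hf.aemeasurable (hg.prodMk hk).aemeasurable, e2,
    ← Measure.prodAssoc_prod, ← e1, ← e3, Measure.map_map (by fun_prop) (by fun_prop)]
  rfl

/-- In an independent family, replace one member `T i` by a function `e (T i)` of it that is
independent of `g (T i)`: the new family is independent of `g (T i)`. -/
lemma ProbabilityTheory.iIndepFun.indepFun_update [IsProbabilityMeasure P] {ι : Type*}
    [DecidableEq ι]
    {T : ι → Ω → α} (hT : ∀ i, Measurable (T i)) (h : iIndepFun T P) (i : ι)
    {g : α → β} {e : α → α} (hg : Measurable g) (he : Measurable e)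
    (hge : IndepFun (fun ω => g (T i ω)) (fun ω => e (T i ω)) P) :
    IndepFun (fun ω => g (T i ω))
      (fun ω => Function.update (fun j => T j ω) i (e (T i ω))) P := by
  have hrest : IndepFun (T i) (fun ω (j : {j // j ≠ i}) => T j ω) P := by
    have := indep_iSup_of_disjoint (S := {i}) (T := {i}ᶜ) (fun j => (hT j).comap_le) h
      disjoint_compl_right
    rw [IndepFun_iff_Indep]
    refine indep_of_indep_of_le_left (indep_of_indep_of_le_right this ?_) ?_
    · simp only [MeasurableSpace.pi, MeasurableSpace.comap_iSup, MeasurableSpace.comap_comp]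
      exact iSup_le fun j => le_iSup₂_of_le (j : ι) j.2 le_rfl
    · exact le_iSup₂_of_le i rfl le_rfl
  have h1 : IndepFun (fun ω => g (T i ω))
      (fun ω => (e (T i ω), fun j : {j // j ≠ i} => T j ω)) P := by
    refine IndepFun.prodMk_of_prodMk (hg.comp (hT i)) (he.comp (hT i))
      (measurable_pi_lambda _ fun j => hT j) hge ?_
    exact hrest.comp (hg.prodMk he) measurable_id
  have hφ : Measurable (fun (p : α × ({j // j ≠ i} → α)) (j : ι) =>
      if hj : j = i then p.1 else p.2 ⟨j, hj⟩) := by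
    refine measurable_pi_lambda _ fun j => ?_
    by_cases hj : j = i
    · simpa [hj] using measurable_fst
    · simp only [hj, dite_false]; fun_prop
  refine (h1.comp measurable_id hφ).congr (Filter.EventuallyEq.rfl)
    (Filter.Eventually.of_forall fun ω => ?_)
  funext j
  by_cases hj : j = i
  · subst hj; simp
  · simp [hj]

end Independence

/-! ### Null sets and distances -/

/-- The distance to a point at height `h` pulls null sets of `ℝ` back to null sets of the plane:
this is why the serving distance has a density. -/
lemma volume_preimage_dist_eq_zero {h : ℝ} {B : Set ℝ} (hB : MeasurableSet B)
    (hB0 : volume B = 0) :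
    volume {x : Plane | Real.sqrt (‖x‖ ^ 2 + h ^ 2) ∈ B} = 0 := by
  set A : Set ℝ := {ρ | Real.sqrt (ρ ^ 2 + h ^ 2) ∈ B} with hA
  have hAm : MeasurableSet A := measurableSet_preimage (by fun_prop) hB
  -- On `(0, ∞)` the distance is inverted by a differentiable function of the distance.
  have hA0 : volume (A ∩ Ioi 0) = 0 := by
    have himg : volume ((fun r : ℝ => Real.sqrt (r ^ 2 - h ^ 2)) '' (B ∩ Ioi |h|)) = 0 := by
      refine MeasureTheory.addHaar_image_eq_zero_of_differentiableOn_of_addHaar_eq_zero _ ?_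
        (measure_mono_null inter_subset_left hB0)
      intro r hr
      have : r ^ 2 - h ^ 2 ≠ 0 := by
        have : h ^ 2 < r ^ 2 := sq_lt_sq.2 (lt_of_lt_of_le hr.2 (le_abs_self r))
        linarith
      refine DifferentiableAt.differentiableWithinAt ?_
      exact DifferentiableAt.sqrt (by fun_prop) this
    refine measure_mono_null ?_ himg
    intro ρ hρ
    have hρ0 : 0 < ρ := hρ.2
    refine ⟨Real.sqrt (ρ ^ 2 + h ^ 2), ⟨hρ.1, ?_⟩, ?_⟩
    · exact Real.lt_sqrt_of_sq_lt (by rw [sq_abs]; nlinarith)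
    · simp only
      rw [Real.sq_sqrt (by positivity), add_sub_cancel_right, Real.sqrt_sq hρ0.le]
  have hn : ∀ n : ℕ, volume {x : Plane | ‖x‖ ∈ A ∩ Iio (n : ℝ)} = 0 := by
    intro n
    have hm : MeasurableSet {x : Plane | ‖x‖ ∈ A ∩ Iio (n : ℝ)} :=
      measurable_norm (hAm.inter measurableSet_Iio)
    have hfin : volume {x : Plane | ‖x‖ ∈ A ∩ Iio (n : ℝ)} ≠ ∞ := by
      refine ((measure_mono ?_).trans_lt
        (measure_ball_lt_top (μ := volume) (x := (0 : Plane)) (r := n))).ne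
      intro x hx
      simpa using hx.2
    -- Polar coordinates; the cutoff at `n` makes the indicator integrable.
    have hpolar := integral_fun_norm_addHaar (volume : Measure Plane)
      ((A ∩ Iio (n : ℝ)).indicator (fun _ => (1 : ℝ)))
    have hzero : ∫ y in Ioi (0 : ℝ), y ^ (Module.finrank ℝ Plane - 1) •
        (A ∩ Iio (n : ℝ)).indicator (fun _ => (1 : ℝ)) y = 0 := by
      refine integral_eq_zero_of_ae ?_
      have : ∀ᵐ y ∂(volume.restrict (Ioi (0 : ℝ))), y ∉ A := by
        rw [ae_restrict_iff' measurableSet_Ioi]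
        have h' : ∀ᵐ y : ℝ, y ∉ A ∩ Ioi 0 := measure_eq_zero_iff_ae_notMem.1 hA0
        filter_upwards [h'] with y hy hy0 hyA using hy ⟨hyA, hy0⟩
      filter_upwards [this] with y hy
      simp [hy]
    rw [hzero] at hpolar
    have hind : (fun x : Plane => (A ∩ Iio (n : ℝ)).indicator (fun _ => (1 : ℝ)) ‖x‖)
        = {x : Plane | ‖x‖ ∈ A ∩ Iio (n : ℝ)}.indicator (fun _ => (1 : ℝ)) := rfl
    rw [hind, integral_indicator_const _ hm] at hpolar
    simp only [smul_eq_mul, mul_one, mul_zero, smul_zero] at hpolar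
    exact (measureReal_eq_zero_iff hfin).1 hpolar
  refine measure_mono_null ?_ (measure_iUnion_null hn)
  intro x hx
  obtain ⟨n, hn⟩ := exists_nat_gt ‖x‖
  exact mem_iUnion.2 ⟨n, hx, hn⟩

/-! ### Laplace transforms and Poisson weights -/

section Laplace

open Classical in
/-- The Laplace transform at `s` of `v + σ`, where `v` has law `κ` and `exp (-s ∞) = 0`. -/
def shiftedLaplace (κ : Measure ℝ≥0∞) (σ s : ℝ) : ℝ :=
  Real.exp (-σ * s) * ∫ v : ℝ≥0∞, (if v = ∞ then 0 else Real.exp (-s * v.toReal)) ∂κ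

/-- The Laplace transform is a moment generating function on the negative half-line, so that its
smoothness and its derivatives are those of `ProbabilityTheory.mgf`. -/
lemma shiftedLaplace_eq_mgf (κ : Measure ℝ≥0∞) (σ : ℝ) :
    shiftedLaplace κ σ = fun s => mgf (fun v => v.toReal + σ) (κ.restrict {∞}ᶜ) (-s) := by
  funext s
  rw [shiftedLaplace, mgf, ← integral_indicator (by measurability), ← integral_const_mul]
  congr 1
  funext v
  by_cases hv : v = ∞
  · simp [hv]
  · simp only [hv, if_false, indicator, mem_compl_iff, mem_singleton_iff, not_false_eq_true,
      if_true]
    rw [← Real.exp_add]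
    ring_nf

lemma Iio_subset_interior_integrableExpSet (κ : Measure ℝ≥0∞) [IsFiniteMeasure κ] {σ : ℝ}
    (hσ : 0 ≤ σ) :
    Iio 0 ⊆ interior (integrableExpSet (fun v : ℝ≥0∞ => v.toReal + σ) (κ.restrict {∞}ᶜ)) := by
  refine interior_maximal (fun t ht => ?_) isOpen_Iio
  refine Integrable.of_bound (C := 1) (by fun_prop) (ae_of_all _ fun v => ?_)
  rw [Real.norm_eq_abs, Real.abs_exp, Real.exp_le_one_iff]
  exact mul_nonpos_of_nonpos_of_nonneg (le_of_lt ht) (by positivity)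

lemma contDiffOn_shiftedLaplace (κ : Measure ℝ≥0∞) [IsFiniteMeasure κ] {σ : ℝ} (hσ : 0 ≤ σ)
    {n : WithTop ℕ∞} : ContDiffOn ℝ n (shiftedLaplace κ σ) (Ioi 0) := by
  rw [shiftedLaplace_eq_mgf]
  have h : ContDiffOn ℝ n (mgf (fun v : ℝ≥0∞ => v.toReal + σ) (κ.restrict {∞}ᶜ)) (Iio 0) :=
    ((analyticOnNhd_mgf.mono (Iio_subset_interior_integrableExpSet κ hσ))).contDiffOn
      (uniqueDiffOn_Iio 0)
  exact h.comp contDiff_neg.contDiffOn fun s hs => by simpa using hs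

lemma iteratedDeriv_shiftedLaplace (κ : Measure ℝ≥0∞) [IsFiniteMeasure κ] {σ s : ℝ} (hσ : 0 ≤ σ)
    (hs : 0 < s) (k : ℕ) :
    iteratedDeriv k (shiftedLaplace κ σ) s = (-1) ^ k *
      ∫ v in {∞}ᶜ, (v.toReal + σ) ^ k * Real.exp (-(s * (v.toReal + σ))) ∂κ := by
  rw [shiftedLaplace_eq_mgf, iteratedDeriv_comp_neg, iteratedDeriv_mgf
    (Iio_subset_interior_integrableExpSet κ hσ (by simpa using hs))]
  simp [neg_mul]

/-- The weight at `k` of the Poisson distribution with mean `s (v + σ)`, and `0` for `v = ∞`. -/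
def poissonTerm (σ : ℝ) (k : ℕ) (s : ℝ) : ℝ≥0∞ → ℝ≥0∞ :=
  indicator {∞}ᶜ fun v =>
    ENNReal.ofReal ((s * (v.toReal + σ)) ^ k / k ! * Real.exp (-(s * (v.toReal + σ))))

lemma measurable_poissonTerm (σ : ℝ) (k : ℕ) :
    Measurable fun p : ℝ × ℝ≥0∞ => poissonTerm σ k p.1 p.2 := by
  have : (fun p : ℝ × ℝ≥0∞ => poissonTerm σ k p.1 p.2) =
      indicator (Prod.snd ⁻¹' {∞}ᶜ) fun p : ℝ × ℝ≥0∞ => ENNReal.ofReal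
        ((p.1 * (p.2.toReal + σ)) ^ k / k ! * Real.exp (-(p.1 * (p.2.toReal + σ)))) := by
    funext p
    simp [poissonTerm, indicator]
  rw [this]
  refine Measurable.indicator (by fun_prop) (measurable_snd (by measurability))

/-- Averaging the Poisson weights produces the derivatives of the Laplace transform. -/
lemma lintegral_poissonTerm (κ : Measure ℝ≥0∞) [IsFiniteMeasure κ] {σ s : ℝ} (hσ : 0 ≤ σ)
    (hs : 0 < s) (k : ℕ) :
    ∫⁻ v, poissonTerm σ k s v ∂κ =
      ENNReal.ofReal (s ^ k / k ! * ((-1) ^ k * iteratedDeriv k (shiftedLaplace κ σ) s)) ∧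
    0 ≤ s ^ k / k ! * ((-1) ^ k * iteratedDeriv k (shiftedLaplace κ σ) s) := by
  have hint : IntegrableOn (fun v : ℝ≥0∞ =>
      s ^ k / k ! * ((v.toReal + σ) ^ k * Real.exp (-(s * (v.toReal + σ))))) {∞}ᶜ κ := by
    have := integrable_pow_mul_exp_of_mem_interior_integrableExpSet
      (Iio_subset_interior_integrableExpSet κ hσ (show -s ∈ Iio 0 by simpa using hs)) k
    simp only [neg_mul] at this
    exact this.const_mul _
  have hval : s ^ k / k ! * ((-1) ^ k * iteratedDeriv k (shiftedLaplace κ σ) s) =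
      ∫ v in {∞}ᶜ, s ^ k / k ! * ((v.toReal + σ) ^ k * Real.exp (-(s * (v.toReal + σ)))) ∂κ := by
    rw [iteratedDeriv_shiftedLaplace κ hσ hs, ← mul_assoc ((-1) ^ k), ← mul_pow,
      integral_const_mul]
    simp
  have hnn : ∀ v : ℝ≥0∞,
      0 ≤ s ^ k / k ! * ((v.toReal + σ) ^ k * Real.exp (-(s * (v.toReal + σ)))) :=
    fun v => by positivity
  rw [hval]
  refine ⟨?_, integral_nonneg hnn⟩
  rw [ofReal_integral_eq_lintegral_ofReal hint (ae_of_all _ hnn)]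
  simp only [poissonTerm]
  rw [lintegral_indicator (by measurability)]
  congr 1
  funext v
  rw [mul_pow]
  ring_nf

end Laplace

/-! ### The rate formula for an independent fading -/

/-- The SINR at serving distance `r`, interference `v` and fading `h`. -/
def sinrOf (μ α σ r : ℝ) (v : ℝ≥0∞) (h : ℝ) : ℝ :=
  (ENNReal.ofReal (μ * r ^ (-α) * h) / (v + ENNReal.ofReal σ)).toReal

lemma sinrOf_nonneg (μ α σ r : ℝ) (v : ℝ≥0∞) (h : ℝ) : 0 ≤ sinrOf μ α σ r v h :=
  ENNReal.toReal_nonneg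

lemma measurable_sinrOf (μ α σ : ℝ) :
    Measurable fun p : (ℝ × ℝ≥0∞) × ℝ => sinrOf μ α σ p.1.1 p.1.2 p.2 := by
  unfold sinrOf
  fun_prop

lemma measurable_log_sinrOf (μ α σ : ℝ) :
    Measurable fun p : (ℝ × ℝ≥0∞) × ℝ => Real.log (1 + sinrOf μ α σ p.1.1 p.1.2 p.2) :=
  Real.measurable_log.comp ((measurable_sinrOf μ α σ).const_add 1)

/-- The tail of `log (1 + γ)` over a Gamma distributed fading. Interference `v = ∞` gives `γ = 0`
and no Poisson weight. -/
lemma gammaMeasure_lt_log_sinrOf {n : ℕ} (hn : n ≠ 0) {μ α σ r t : ℝ} (hμ : 0 < μ) (hσ : 0 < σ)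
    (hr : 0 < r) (ht : 0 < t) (v : ℝ≥0∞) :
    gammaMeasure n n {h | t < Real.log (1 + sinrOf μ α σ r v h)} =
      ∑ k ∈ Finset.range n, poissonTerm σ k (n * (Real.exp t - 1) * r ^ α / μ) v := by
  by_cases hv : v = ∞
  · simp [hv, sinrOf, poissonTerm, ht.not_gt]
  have het : 0 < Real.exp t - 1 := by
    have := Real.add_one_lt_exp ht.ne'
    linarith
  have hV : 0 < v.toReal + σ := by positivity
  have hrα : 0 < r ^ α := Real.rpow_pos_of_pos hr α
  have hset : {h | t < Real.log (1 + sinrOf μ α σ r v h)} =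
      Ioi ((Real.exp t - 1) * (v.toReal + σ) * r ^ α / μ) := by
    ext h
    have hs : sinrOf μ α σ r v h = max (μ * (r ^ α)⁻¹ * h / (v.toReal + σ)) 0 := by
      have : v + ENNReal.ofReal σ = ENNReal.ofReal (v.toReal + σ) := by
        rw [ENNReal.ofReal_add (by positivity) hσ.le, ENNReal.ofReal_toReal hv]
      rw [sinrOf, this, ← ENNReal.ofReal_div_of_pos hV, Real.rpow_neg hr.le, ENNReal.toReal_ofReal']
    have h1 : 0 < 1 + sinrOf μ α σ r v h := by
      linarith [sinrOf_nonneg μ α σ r v h]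
    rw [mem_ofPred_eq, mem_Ioi, Real.lt_log_iff_exp_lt h1, ← sub_lt_iff_lt_add', hs, lt_max_iff,
      or_iff_left het.not_gt, lt_div_iff₀ hV, div_lt_iff₀ hμ,
      show μ * (r ^ α)⁻¹ * h = h * μ / r ^ α by ring, lt_div_iff₀ hrα]
  rw [hset, gammaMeasure_Ioi hn (by positivity) (by positivity), ENNReal.ofReal_sum_of_nonneg]
  · refine Finset.sum_congr rfl fun k _ => ?_
    simp only [poissonTerm, indicator, mem_compl_iff, mem_singleton_iff, hv, not_false_eq_true,
      if_true]
    congr 1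
    ring_nf
  · intro k _
    positivity

section Rate

variable {Ω : Type*} [MeasurableSpace Ω] {Q : Measure Ω}
  {R H : Ω → ℝ} {I : Ω → ℝ≥0∞} {μ α σ m : ℝ} {n : ℕ}

/-- The `k`-th term of the integrand that represents the expectation of `log (1 + γ)`. -/
def rateDensity (Q : Measure Ω) [IsProbabilityMeasure Q] (R : Ω → ℝ) (I : Ω → ℝ≥0∞)
    (μ α σ m : ℝ) (k : ℕ) (p : ℝ × ℝ) : ℝ≥0∞ :=
  pdf R Q volume p.2 *
    ∫⁻ v, poissonTerm σ k (m * (Real.exp p.1 - 1) * p.2 ^ α / μ) v ∂(condDistrib I R Q p.2)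

lemma measurable_rateDensity [IsProbabilityMeasure Q] (k : ℕ) :
    Measurable (rateDensity Q R I μ α σ m k) := by
  refine ((measurable_pdf R Q volume).comp measurable_snd).mul ?_
  have h := Measurable.lintegral_kernel_prod_right'
    (κ := (condDistrib I R Q).comap (Prod.snd : ℝ × ℝ → ℝ) measurable_snd)
    (f := fun q : (ℝ × ℝ) × ℝ≥0∞ =>
      poissonTerm σ k (m * (Real.exp q.1.1 - 1) * q.1.2 ^ α / μ) q.2)
    ((measurable_poissonTerm σ k).comp
      (f := fun q : (ℝ × ℝ) × ℝ≥0∞ => (m * (Real.exp q.1.1 - 1) * q.1.2 ^ α / μ, q.2))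
      (by fun_prop))
  exact h

/-- The density vanishes almost everywhere outside a set that contains the random variable. -/
lemma ae_mem_or_pdf_eq_zero [HasPDF R Q volume] {S : Set ℝ} (hS : MeasurableSet S)
    (hRS : ∀ᵐ ω ∂Q, R ω ∈ S) : ∀ᵐ r : ℝ, r ∈ S ∨ pdf R Q volume r = 0 := by
  have h : ∫⁻ r in Sᶜ, pdf R Q volume r = 0 := by
    rw [← map_eq_setLIntegral_pdf R Q volume hS.compl,
      Measure.map_apply_of_aemeasurable (HasPDF.aemeasurable R Q volume) hS.compl]
    exact hRS
  rw [lintegral_eq_zero_iff (measurable_pdf R Q volume), Filter.EventuallyEq,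
    ae_restrict_iff' hS.compl] at h
  filter_upwards [h] with r hr
  by_cases hrS : r ∈ S
  · exact Or.inl hrS
  · exact Or.inr (hr hrS)

/-- If the fading `H` is Gamma distributed and independent of the serving distance `R` and the
interference `I`, integrating the tail of `log (1 + γ)` first over `H` and then over the conditional
law of `I` given `R` expresses its expectation through the Poisson weights. -/
lemma lintegral_log_sinrOf [IsProbabilityMeasure Q] [HasPDF R Q volume]
    (hI : AEMeasurable I Q) (hH : AEMeasurable H Q)
    (hn : n ≠ 0) (hμ : 0 < μ) (hσ : 0 < σ)
    (hlaw : Q.map (fun ω => ((R ω, I ω), H ω)) =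
      (Q.map fun ω => (R ω, I ω)).prod (gammaMeasure n n))
    (hR : ∀ᵐ ω ∂Q, 0 < R ω) :
    ∫⁻ ω, ENNReal.ofReal (Real.log (1 + sinrOf μ α σ (R ω) (I ω) (H ω))) ∂Q =
      ∑ k ∈ Finset.range n, ∫⁻ p in Ioi 0 ×ˢ univ, rateDensity Q R I μ α σ n k p := by
  have hRm : AEMeasurable R Q := HasPDF.aemeasurable R Q volume
  have hn0 : (0 : ℝ) < n := by positivity
  have := isProbabilityMeasure_gammaMeasure hn0 hn0
  have hΦ : Measurable fun p : (ℝ × ℝ≥0∞) × ℝ =>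
      Real.log (1 + sinrOf μ α σ p.1.1 p.1.2 p.2) := measurable_log_sinrOf μ α σ
  rw [lintegral_eq_lintegral_meas_lt Q
    (ae_of_all _ fun ω => Real.log_nonneg (by linarith [sinrOf_nonneg μ α σ (R ω) (I ω) (H ω)]))
    (hΦ.comp_aemeasurable ((hRm.prodMk hI).prodMk hH))]
  have hsum : ∀ t ∈ Ioi (0 : ℝ),
      Q {ω | t < Real.log (1 + sinrOf μ α σ (R ω) (I ω) (H ω))} =
        ∫⁻ r, ∑ k ∈ Finset.range n, rateDensity Q R I μ α σ n k (t, r) := by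
    intro t ht
    have hset : MeasurableSet {p : (ℝ × ℝ≥0∞) × ℝ |
        t < Real.log (1 + sinrOf μ α σ p.1.1 p.1.2 p.2)} :=
      measurableSet_lt measurable_const hΦ
    have hpois : ∀ k, Measurable fun p : ℝ × ℝ≥0∞ =>
        poissonTerm σ k (n * (Real.exp t - 1) * p.1 ^ α / μ) p.2 := fun k =>
      (measurable_poissonTerm σ k).comp
        (f := fun q : ℝ × ℝ≥0∞ => (n * (Real.exp t - 1) * q.1 ^ α / μ, q.2)) (by fun_prop)
    have hpos : ∀ᵐ p ∂(Q.map fun ω => (R ω, I ω)), 0 < p.1 :=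
      (ae_map_iff (hRm.prodMk hI) (measurableSet_lt measurable_const measurable_fst)).2 hR
    calc Q {ω | t < Real.log (1 + sinrOf μ α σ (R ω) (I ω) (H ω))}
        = (Q.map fun ω => ((R ω, I ω), H ω))
            {p | t < Real.log (1 + sinrOf μ α σ p.1.1 p.1.2 p.2)} := by
          rw [Measure.map_apply_of_aemeasurable ((hRm.prodMk hI).prodMk hH) hset]
          rfl
      _ = ∫⁻ p, ∑ k ∈ Finset.range n,
            poissonTerm σ k (n * (Real.exp t - 1) * p.1 ^ α / μ) p.2
              ∂(Q.map fun ω => (R ω, I ω)) := by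
          rw [hlaw, Measure.prod_apply hset]
          refine lintegral_congr_ae ?_
          filter_upwards [hpos] with p hp
          exact gammaMeasure_lt_log_sinrOf hn hμ hσ hp ht p.2
      _ = ∫⁻ r, ∫⁻ v, ∑ k ∈ Finset.range n,
            poissonTerm σ k (n * (Real.exp t - 1) * r ^ α / μ) v
              ∂(condDistrib I R Q r) ∂(Q.map R) := by
          rw [← compProd_map_condDistrib hI, Measure.lintegral_compProd
            (Finset.measurable_fun_sum _ fun k _ => hpois k)]
      _ = ∫⁻ r, pdf R Q volume r * ∫⁻ v, ∑ k ∈ Finset.range n,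
            poissonTerm σ k (n * (Real.exp t - 1) * r ^ α / μ) v ∂(condDistrib I R Q r) := by
          conv_lhs => rw [map_eq_withDensity_pdf R Q volume]
          rw [lintegral_withDensity_eq_lintegral_mul _ (measurable_pdf R Q volume)]
          · rfl
          · exact Measurable.lintegral_kernel_prod_right'
              (f := fun p : ℝ × ℝ≥0∞ => ∑ k ∈ Finset.range n,
                poissonTerm σ k (n * (Real.exp t - 1) * p.1 ^ α / μ) p.2)
              (Finset.measurable_fun_sum _ fun k _ => hpois k)
      _ = _ := by
          refine lintegral_congr fun r => ?_
          have hpoisr : ∀ k, Measurable fun v : ℝ≥0∞ =>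
              poissonTerm σ k (n * (Real.exp t - 1) * r ^ α / μ) v := fun k =>
            (measurable_poissonTerm σ k).comp
              (f := fun v : ℝ≥0∞ => (n * (Real.exp t - 1) * r ^ α / μ, v)) (by fun_prop)
          rw [lintegral_finsetSum _ fun k _ => hpoisr k,
            Finset.mul_sum]
          rfl
  rw [setLIntegral_congr_fun measurableSet_Ioi hsum]
  have hk : ∀ k, Measurable fun p : ℝ × ℝ => rateDensity Q R I μ α σ n k p :=
    fun k => measurable_rateDensity k
  rw [← lintegral_finsetSum _ fun k _ => hk k, Measure.volume_eq_prod, ← Measure.prod_restrict,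
    Measure.restrict_univ, lintegral_prod _
      (Finset.measurable_fun_sum _ fun k _ => hk k).aemeasurable]

/-- The expectation of `log (1 + γ)` is finite: `log (1 + γ) ≤ γ`, the noise bounds the denominator
of `γ` from below, `h₀` bounds the distance from below, and the fading has a finite mean. -/
lemma lintegral_log_sinrOf_lt_top (hH : AEMeasurable H Q)
    {a l h₀ : ℝ} (ha : 0 < a) (hl : 0 < l) (hμ : 0 < μ) (hα : 0 < α) (hσ : 0 < σ)
    (hlaw : Q.map H = gammaMeasure a l) (h₀_pos : 0 < h₀) (hR : ∀ᵐ ω ∂Q, h₀ ≤ R ω) :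
    ∫⁻ ω, ENNReal.ofReal (Real.log (1 + sinrOf μ α σ (R ω) (I ω) (H ω))) ∂Q < ∞ := by
  set C := ENNReal.ofReal (μ * h₀ ^ (-α)) / ENNReal.ofReal σ with hC
  have hCtop : C ≠ ∞ := ENNReal.div_ne_top ENNReal.ofReal_ne_top (by simpa using hσ)
  have hle : ∀ᵐ ω ∂Q, ENNReal.ofReal (Real.log (1 + sinrOf μ α σ (R ω) (I ω) (H ω)))
      ≤ C * ENNReal.ofReal (H ω) := by
    filter_upwards [hR] with ω hω
    have hlog : Real.log (1 + sinrOf μ α σ (R ω) (I ω) (H ω)) ≤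
        sinrOf μ α σ (R ω) (I ω) (H ω) := by
      have h0 := sinrOf_nonneg μ α σ (R ω) (I ω) (H ω)
      have := Real.log_le_sub_one_of_pos (x := 1 + sinrOf μ α σ (R ω) (I ω) (H ω)) (by linarith)
      linarith
    refine (ENNReal.ofReal_le_ofReal hlog).trans (ENNReal.ofReal_toReal_le.trans ?_)
    have hpow : R ω ^ (-α) ≤ h₀ ^ (-α) :=
      Real.rpow_le_rpow_of_nonpos h₀_pos hω (by linarith)
    have h1 : 0 ≤ μ * R ω ^ (-α) := by
      have := Real.rpow_nonneg (h₀_pos.le.trans hω) (-α)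
      positivity
    rw [hC, ← ENNReal.mul_div_right_comm, ENNReal.ofReal_mul h1]
    gcongr
    exact le_add_self
  refine (lintegral_mono_ae hle).trans_lt ?_
  rw [lintegral_const_mul' _ _ hCtop]
  refine ENNReal.mul_lt_top hCtop.lt_top ?_
  have := lintegral_gammaMeasure_lt_top ha hl
  rwa [← hlaw, lintegral_map' (by fun_prop) hH] at this

/-- The rate formula for a serving distance `R` with a density, an interference `I` and an
independent fading `H` with a Gamma distribution of integer shape. -/
lemma rate_formula [IsProbabilityMeasure Q] [HasPDF R Q volume]
    (hI : AEMeasurable I Q) (hH : AEMeasurable H Q)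
    (hm : m = n) (hn : n ≠ 0) (hμ : 0 < μ) (hα : 0 < α) (hσ : 0 < σ)
    (hlaw : Q.map (fun ω => ((R ω, I ω), H ω)) =
      (Q.map fun ω => (R ω, I ω)).prod (gammaMeasure m m))
    {D : Set ℝ} (hD : MeasurableSet D) {h₀ : ℝ} (h₀_pos : 0 < h₀) (hDh : D ⊆ Ici h₀)
    (hR : ∀ᵐ ω ∂Q, R ω ∈ D) {γ : Ω → ℝ}
    (hγ : ∀ᵐ ω ∂Q, γ ω = sinrOf μ α σ (R ω) (I ω) (H ω)) :
    Integrable (fun ω => Real.logb 2 (1 + γ ω)) Q ∧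
    ∀ S : Set ℝ, MeasurableSet S → D ⊆ S →
      (∀ k < n, IntegrableOn
        (fun p : ℝ × ℝ => p.2 ^ (k * α) * (Real.exp p.1 - 1) ^ k *
          iteratedDeriv k (shiftedLaplace (condDistrib I R Q p.2) σ)
            (m * (Real.exp p.1 - 1) * p.2 ^ α / μ) *
          (pdf R Q volume p.2).toReal) (Ioi 0 ×ˢ S)) ∧
      ∫ ω, Real.logb 2 (1 + γ ω) ∂Q =
        ∑ k ∈ Finset.range n, (-1) ^ k / (Real.log 2 * k !) * (m / μ) ^ k *
          ∫ t in Ioi (0 : ℝ), ∫ r in S,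
            r ^ (k * α) * (Real.exp t - 1) ^ k *
              iteratedDeriv k (shiftedLaplace (condDistrib I R Q r) σ)
                (m * (Real.exp t - 1) * r ^ α / μ) *
              (pdf R Q volume r).toReal := by
  subst hm
  have hRm : AEMeasurable R Q := HasPDF.aemeasurable R Q volume
  have hn0 : (0 : ℝ) < n := by positivity
  have := isProbabilityMeasure_gammaMeasure hn0 hn0
  have hRI : IsProbabilityMeasure (Q.map fun ω => (R ω, I ω)) :=
    Measure.isProbabilityMeasure_map (hRm.prodMk hI)
  have hlawH : Q.map H = gammaMeasure n n := by
    have h1 : (Q.map fun ω => ((R ω, I ω), H ω)).map Prod.snd = Q.map H := by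
      rw [AEMeasurable.map_map_of_aemeasurable (by fun_prop) ((hRm.prodMk hI).prodMk hH)]
      rfl
    rw [← h1, hlaw, Measure.map_snd_prod, measure_univ, one_smul]
  have hRh : ∀ᵐ ω ∂Q, h₀ ≤ R ω := by
    filter_upwards [hR] with ω hω using hDh hω
  have hRpos : ∀ᵐ ω ∂Q, 0 < R ω := by
    filter_upwards [hRh] with ω hω using h₀_pos.trans_le hω
  set J := ∫⁻ ω, ENNReal.ofReal (Real.log (1 + sinrOf μ α σ (R ω) (I ω) (H ω))) ∂Q with hJ
  have hJsum : J = ∑ k ∈ Finset.range n, ∫⁻ p in Ioi 0 ×ˢ univ, rateDensity Q R I μ α σ n k p :=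
    lintegral_log_sinrOf hI hH hn hμ hσ hlaw hRpos
  have hJtop : J < ∞ :=
    lintegral_log_sinrOf_lt_top hH hn0 hn0 hμ hα hσ hlawH h₀_pos hRh
  have hlogm : AEMeasurable (fun ω => Real.log (1 + sinrOf μ α σ (R ω) (I ω) (H ω))) Q :=
    (measurable_log_sinrOf μ α σ).comp_aemeasurable
      (f := fun ω => ((R ω, I ω), H ω)) ((hRm.prodMk hI).prodMk hH)
  have hlognn : ∀ ω, 0 ≤ Real.log (1 + sinrOf μ α σ (R ω) (I ω) (H ω)) := fun ω =>
    Real.log_nonneg (by linarith [sinrOf_nonneg μ α σ (R ω) (I ω) (H ω)])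
  have hlogint : Integrable (fun ω => Real.log (1 + sinrOf μ α σ (R ω) (I ω) (H ω))) Q :=
    (lintegral_ofReal_ne_top_iff_integrable hlogm.aestronglyMeasurable
      (ae_of_all _ hlognn)).1 hJtop.ne
  have hlogb : (fun ω => Real.logb 2 (1 + γ ω)) =ᵐ[Q]
      fun ω => Real.log (1 + sinrOf μ α σ (R ω) (I ω) (H ω)) / Real.log 2 := by
    filter_upwards [hγ] with ω hω
    rw [hω, Real.logb]
  refine ⟨(hlogint.div_const _).congr hlogb.symm, fun S hS hDS => ?_⟩
  -- The integrand of the statement, and the constant that turns it into the Poisson weights.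
  set F : ℕ → ℝ × ℝ → ℝ := fun k p => p.2 ^ (k * α) * (Real.exp p.1 - 1) ^ k *
          iteratedDeriv k (shiftedLaplace (condDistrib I R Q p.2) σ)
            (n * (Real.exp p.1 - 1) * p.2 ^ α / μ) * (pdf R Q volume p.2).toReal with hF
  set C : ℕ → ℝ := fun k => (-1) ^ k / k ! * (n / μ) ^ k with hC
  have hC0 : ∀ k, C k ≠ 0 := fun k => by
    simp only [hC]
    positivity
  have hzero : ∀ᵐ r : ℝ, r ∈ D ∨ pdf R Q volume r = 0 := ae_mem_or_pdf_eq_zero hD hR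
  have hEF : ∀ k, ∀ᵐ p ∂((volume : Measure (ℝ × ℝ)).restrict (Ioi 0 ×ˢ univ)),
      (rateDensity Q R I μ α σ n k p).toReal = C k * F k p := by
    intro k
    have hz : ∀ᵐ p : ℝ × ℝ, p.2 ∈ D ∨ pdf R Q volume p.2 = 0 :=
      Measure.quasiMeasurePreserving_snd.ae hzero
    rw [ae_restrict_iff' (measurableSet_Ioi.prod MeasurableSet.univ)]
    filter_upwards [hz] with p hp hpt
    rcases hp with hp | hp
    · have hr : 0 < p.2 := h₀_pos.trans_le (hDh hp)
      have het : 0 < Real.exp p.1 - 1 := by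
        have := Real.add_one_lt_exp (ne_of_gt hpt.1)
        have : (0 : ℝ) < p.1 := hpt.1
        linarith
      have hrα := Real.rpow_pos_of_pos hr α
      obtain ⟨h1, h2⟩ := lintegral_poissonTerm (condDistrib I R Q p.2) hσ.le
        (s := n * (Real.exp p.1 - 1) * p.2 ^ α / μ) (by positivity) k
      rw [rateDensity, h1, ENNReal.toReal_mul, ENNReal.toReal_ofReal h2]
      simp only [hF, hC]
      rw [mul_comm (k : ℝ) α, Real.rpow_mul hr.le, Real.rpow_natCast, div_pow, div_pow,
        mul_pow, mul_pow]
      ring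
    · simp [rateDensity, hF, hp]
  have hEfin : ∀ k < n, ∫⁻ p in Ioi 0 ×ˢ univ, rateDensity Q R I μ α σ n k p ≠ ∞ := by
    intro k hk
    rw [hJsum] at hJtop
    exact (ENNReal.sum_lt_top.1 hJtop k (Finset.mem_range.2 hk)).ne
  have hFint : ∀ k < n, IntegrableOn (F k) (Ioi 0 ×ˢ univ) := by
    intro k hk
    have h1 : IntegrableOn (fun p => (rateDensity Q R I μ α σ n k p).toReal) (Ioi 0 ×ˢ univ) :=
      integrable_toReal_of_lintegral_ne_top (measurable_rateDensity k).aemeasurable (hEfin k hk)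
    refine (h1.const_mul (C k)⁻¹).congr ?_
    filter_upwards [hEF k] with p hp
    rw [hp, inv_mul_cancel_left₀ (hC0 k)]
  refine ⟨fun k hk => (hFint k hk).mono_set (prod_mono_right (subset_univ S)), ?_⟩
  have hSint : ∀ k < n, ∫ t in Ioi (0 : ℝ), ∫ r in S, F k (t, r) =
      (C k)⁻¹ * (∫⁻ p in Ioi 0 ×ˢ univ, rateDensity Q R I μ α σ n k p).toReal := by
    intro k hk
    have h1 : ∀ t, ∫ r in S, F k (t, r) = ∫ r in univ, F k (t, r) := by
      intro t
      rw [setIntegral_univ]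
      refine setIntegral_eq_integral_of_ae_compl_eq_zero ?_
      filter_upwards [hzero] with r hr hrS
      rcases hr with hr | hr
      · exact absurd (hDS hr) hrS
      · simp [hF, hr]
    simp_rw [h1]
    rw [← setIntegral_prod (F k) (hFint k hk), ← integral_toReal
      (measurable_rateDensity k).aemeasurable
      (ae_lt_top (measurable_rateDensity k) (hEfin k hk)), ← Measure.volume_eq_prod,
      integral_congr_ae (hEF k), integral_const_mul, inv_mul_cancel_left₀ (hC0 k)]
  rw [integral_congr_ae hlogb, integral_div,
    integral_eq_lintegral_of_nonneg_ae (ae_of_all _ hlognn) hlogm.aestronglyMeasurable, ← hJ, hJsum,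
    ENNReal.toReal_sum fun k hk => hEfin k (Finset.mem_range.1 hk), Finset.sum_div]
  refine Finset.sum_congr rfl fun k hk => ?_
  have h := hSint k (Finset.mem_range.1 hk)
  simp only [hF] at h
  rw [h]
  have hl2 : Real.log 2 ≠ 0 := (Real.log_pos one_lt_two).ne'
  have hCk : (-1 : ℝ) ^ k / (Real.log 2 * k !) * (n / μ) ^ k = C k / Real.log 2 := by
    simp only [hC]
    field_simp
  rw [hCk, div_mul_eq_mul_div, mul_inv_cancel_left₀ (hC0 k)]

end Rate

/-! ### Independence on a disjoint union of events -/

section Mixture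

variable {Ω β δ ι : Type*} [MeasurableSpace Ω] [MeasurableSpace β] [MeasurableSpace δ]
  [Countable ι] {P : Measure Ω} {A : ι → Set Ω}

lemma aemeasurable_cond_iUnion {W : Ω → β} {Wx : ι → Ω → β} (hA : ∀ x, MeasurableSet (A x))
    (hWx : ∀ x, Measurable (Wx x)) (hW : ∀ x, ∀ ω ∈ A x, W ω = Wx x ω) :
    AEMeasurable W (ProbabilityTheory.cond P (⋃ x, A x)) := by
  refine AEMeasurable.smul_measure ((aemeasurable_iUnion_iff).2 fun x => ?_) _
  refine (hWx x).aemeasurable.congr ?_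
  rw [Filter.EventuallyEq, ae_restrict_iff' (hA x)]
  exact ae_of_all _ fun ω hω => (hW x ω hω).symm

lemma cond_iUnion_apply [IsProbabilityMeasure P] (hA : ∀ x, MeasurableSet (A x))
    (hdisj : Pairwise (Function.onFun Disjoint A)) (S : Set Ω) :
    ProbabilityTheory.cond P (⋃ x, A x) S = (P (⋃ x, A x))⁻¹ * ∑' x, P (A x ∩ S) := by
  have hE : MeasurableSet (⋃ x, A x) := MeasurableSet.iUnion hA
  rw [cond_apply hE, inter_comm, ← Measure.restrict_apply' hE, Measure.restrict_iUnion hdisj hA,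
    Measure.sum_apply_of_countable]
  simp_rw [Measure.restrict_apply' (hA _), inter_comm S]

/-- Conditionally on the disjoint union of events `A x`, let `(W, H)` coincide with `(Wx x, Hx x)`
on `A x`. If each `Hx x` has law `ρ` and is independent of `A x` and `Wx x`, then `H` has law `ρ`
and is independent of `W`. -/
lemma map_cond_iUnion_eq_prod [IsProbabilityMeasure P] {W : Ω → β} {Wx : ι → Ω → β} {H : Ω → δ}
    {Hx : ι → Ω → δ} {ρ : Measure δ} [SigmaFinite ρ] (hA : ∀ x, MeasurableSet (A x))
    (hdisj : Pairwise (Function.onFun Disjoint A))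
    (hWx : ∀ x, Measurable (Wx x)) (hW : ∀ x, ∀ ω ∈ A x, W ω = Wx x ω)
    (hHx : ∀ x, Measurable (Hx x)) (hH : ∀ x, ∀ ω ∈ A x, H ω = Hx x ω)
    (hind : ∀ x B C, MeasurableSet B → MeasurableSet C →
      P (A x ∩ (Wx x ⁻¹' B ∩ Hx x ⁻¹' C)) = P (A x ∩ Wx x ⁻¹' B) * ρ C) :
    (ProbabilityTheory.cond P (⋃ x, A x)).map (fun ω => (W ω, H ω)) =
      ((ProbabilityTheory.cond P (⋃ x, A x)).map W).prod ρ := by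
  have hWm : AEMeasurable W (ProbabilityTheory.cond P (⋃ x, A x)) :=
    aemeasurable_cond_iUnion hA hWx hW
  have hHm : AEMeasurable H (ProbabilityTheory.cond P (⋃ x, A x)) :=
    aemeasurable_cond_iUnion hA hHx hH
  symm
  refine Measure.prod_eq fun B C hB hC => ?_
  rw [Measure.map_apply_of_aemeasurable (hWm.prodMk hHm) (hB.prod hC),
    Measure.map_apply_of_aemeasurable hWm hB, cond_iUnion_apply hA hdisj,
    cond_iUnion_apply hA hdisj, mul_assoc, ← ENNReal.tsum_mul_right]
  congr 2
  funext x
  have h1 : A x ∩ W ⁻¹' B = A x ∩ Wx x ⁻¹' B := by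
    ext ω
    refine and_congr_right fun hω => ?_
    rw [mem_preimage, mem_preimage, hW x ω hω]
  have h2 : A x ∩ (fun ω => (W ω, H ω)) ⁻¹' B ×ˢ C = A x ∩ (Wx x ⁻¹' B ∩ Hx x ⁻¹' C) := by
    ext ω
    refine and_congr_right fun hω => ?_
    rw [mem_preimage, mem_prod, mem_inter_iff, mem_preimage, mem_preimage, hW x ω hω, hH x ω hω]
  rw [h1, h2, hind x B C hB hC]

end Mixture

/-! ### Configurations of the network -/

namespace VHetNet

variable {net : VHetNet}

/-- A configuration of the network: the positions of the terrestrial BSs, their marks (line-of-sight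
mark and the two candidate fading gains), and the positions, antenna gains and fading gains of the
aerial BSs. -/
abbrev Config (net : VHetNet) : Type :=
  (ℕ → Plane) × (ℕ → ℝ × ℝ × ℝ) × (Fin net.N → Plane × ℝ × ℝ)

namespace Config

open Classical in
/-- The tier of a BS. -/
def tier (c : Config net) : ℕ ⊕ Fin net.N → Tier
  | .inl j => if (c.2.1 j).1 ≤ net.PL ‖c.1 j‖ then .L else .N
  | .inr _ => .A

/-- The distance between the user and a BS. -/
def dist (c : Config net) : ℕ ⊕ Fin net.N → ℝ
  | .inl j => Real.sqrt (‖c.1 j‖ ^ 2 + net.hUT ^ 2)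
  | .inr i => Real.sqrt (‖(c.2.2 i).1‖ ^ 2 + net.hUA ^ 2)

/-- The fading gain that a BS has if it belongs to tier `ν`. -/
def gain (ν : Tier) (c : Config net) : ℕ ⊕ Fin net.N → ℝ
  | .inl j => match ν with
    | .L => (c.2.1 j).2.1
    | _ => (c.2.1 j).2.2
  | .inr i => (c.2.2 i).2.2

/-- The averaged power received from a BS if it serves the user. -/
def avgPower (c : Config net) (x : ℕ ⊕ Fin net.N) : ℝ :=
  net.mu (c.tier x) * c.dist x ^ (-net.alpha (c.tier x))

/-- The power received from a BS if it interferes. -/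
def interfPower (c : Config net) : ℕ ⊕ Fin net.N → ℝ
  | .inl j => net.mu (c.tier (.inl j)) * c.gain (c.tier (.inl j)) (.inl j)
      * c.dist (.inl j) ^ (-net.alpha (c.tier (.inl j)))
  | .inr i => net.PA * (c.2.2 i).2.1 * net.eta .A * c.gain .A (.inr i)
      * c.dist (.inr i) ^ (-net.alpha .A)

/-- The configurations in which the BS `x` serves the user and belongs to tier `ν`. -/
def servedBy (net : VHetNet) (ν : Tier) (x : ℕ ⊕ Fin net.N) : Set (Config net) :=
  {c | (∀ y, y ≠ x → c.avgPower y < c.avgPower x) ∧ c.tier x = ν}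

open Classical in
/-- The interference from the BSs of tier `τ` other than `x`. -/
def tierInterf (τ : Tier) (x : ℕ ⊕ Fin net.N) (c : Config net) : ℝ≥0∞ :=
  ∑' y, if y ≠ x ∧ c.tier y = τ then ENNReal.ofReal (c.interfPower y) else 0

/-- The aggregate interference if `x` serves the user and belongs to tier `ν`. -/
def interf (pol : Policy) (ν : Tier) (x : ℕ ⊕ Fin net.N) (c : Config net) : ℝ≥0∞ :=
  match pol, ν with
  | .NOSS, _ => tierInterf .L x c + tierInterf .N x c + tierInterf .A x c
  | .OSS, .A => tierInterf .A x c
  | .OSS, _ => tierInterf .L x c + tierInterf .N x c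

/-- Erase the fading gains of the BS `x`. For an aerial BS its antenna gain, which matters only when
it interferes, is erased as well. -/
def erase (x : ℕ ⊕ Fin net.N) (c : Config net) : Config net :=
  match x with
  | .inl j => (c.1, Function.update c.2.1 j ((c.2.1 j).1, 0, 0), c.2.2)
  | .inr i => (c.1, c.2.1, Function.update c.2.2 i ((c.2.2 i).1, 0, 0))

lemma tier_erase (x y : ℕ ⊕ Fin net.N) (c : Config net) : (erase x c).tier y = c.tier y := by
  rcases x with j | i <;> rcases y with j' | i'
  · by_cases h : j' = j
    · subst h; simp [erase, tier]
    · simp [erase, tier, h]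
  all_goals rfl

lemma dist_erase (x y : ℕ ⊕ Fin net.N) (c : Config net) : (erase x c).dist y = c.dist y := by
  rcases x with j | i <;> rcases y with j' | i'
  any_goals rfl
  by_cases h : i' = i
  · subst h; simp [erase, dist]
  · simp [erase, dist, h]

lemma interfPower_erase {x y : ℕ ⊕ Fin net.N} (h : y ≠ x) (c : Config net) :
    (erase x c).interfPower y = c.interfPower y := by
  rcases x with j | i <;> rcases y with j' | i' <;>
    simp only [interfPower, tier_erase, dist_erase]
  · have h' : j' ≠ j := fun e => h (by rw [e])
    simp only [gain, erase, ne_eq, h', not_false_eq_true, Function.update_of_ne]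
  · rfl
  · rfl
  · have h' : i' ≠ i := fun e => h (by rw [e])
    simp only [gain, erase, ne_eq, h', not_false_eq_true, Function.update_of_ne]

lemma erase_mem_servedBy {ν : Tier} {x : ℕ ⊕ Fin net.N} {c : Config net} :
    erase x c ∈ servedBy net ν x ↔ c ∈ servedBy net ν x := by
  simp only [servedBy, mem_ofPred_eq, avgPower, tier_erase, dist_erase]

/-- The interference seen when `x` serves excludes `x`, so that erasing the gains of `x` does not
change it. -/
lemma interf_erase (pol : Policy) (ν : Tier) (x : ℕ ⊕ Fin net.N) (c : Config net) :
    interf pol ν x (erase x c) = interf pol ν x c := by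
  have h : ∀ τ, tierInterf τ x (erase x c) = tierInterf τ x c := by
    intro τ
    unfold tierInterf
    congr 1
    funext y
    by_cases hy : y = x
    · simp [hy]
    · rw [interfPower_erase hy]
      classical exact if_congr (by rw [tier_erase]) rfl rfl
  simp only [interf, h]

/-- A quantity that depends on the tier of a BS is measurable if it is so for each fixed tier. -/
lemma measurable_comp_tier {δ : Type*} [MeasurableSpace δ] {f : Tier → Config net → δ}
    (hf : ∀ τ, Measurable (f τ)) (x : ℕ ⊕ Fin net.N) :
    Measurable fun c : Config net => f (c.tier x) c := by
  rcases x with j | i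
  · have hset : MeasurableSet {c : Config net | (c.2.1 j).1 ≤ net.PL ‖c.1 j‖} := by
      unfold PL
      refine measurableSet_le (by fun_prop) ?_
      have : Measurable fun c : Config net => Real.arctan (net.hUT / ‖c.1 j‖) :=
        Real.measurable_arctan.comp (by fun_prop)
      fun_prop
    have : (fun c : Config net => f (c.tier (.inl j)) c) =
        fun c => if (c.2.1 j).1 ≤ net.PL ‖c.1 j‖ then f .L c else f .N c := by
      funext c
      simp only [tier]
      split_ifs <;> rfl
    rw [this]
    exact Measurable.ite hset (hf _) (hf _)
  · exact hf .A

lemma measurableSet_tier_eq (x : ℕ ⊕ Fin net.N) (τ : Tier) :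
    MeasurableSet {c : Config net | c.tier x = τ} :=
  measurableSet_setOfPred.2 (measurable_comp_tier (f := fun σ _ => σ = τ)
    (fun _ => measurable_const) x)

lemma measurable_dist (x : ℕ ⊕ Fin net.N) : Measurable fun c : Config net => c.dist x := by
  rcases x with j | i <;> simp only [dist] <;> fun_prop

lemma measurable_gain (ν : Tier) (x : ℕ ⊕ Fin net.N) :
    Measurable fun c : Config net => c.gain ν x := by
  rcases x with j | i <;> rcases ν <;> simp only [gain] <;> fun_prop

lemma measurable_avgPower (x : ℕ ⊕ Fin net.N) : Measurable fun c : Config net => c.avgPower x :=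
  measurable_comp_tier (f := fun τ c => net.mu τ * c.dist x ^ (-net.alpha τ))
    (fun τ => by have := measurable_dist (net := net) x; fun_prop) x

lemma measurable_interfPower (x : ℕ ⊕ Fin net.N) :
    Measurable fun c : Config net => c.interfPower x := by
  have hd := measurable_dist (net := net) x
  rcases x with j | i
  · refine measurable_comp_tier
      (f := fun τ c => net.mu τ * c.gain τ (.inl j) * c.dist (.inl j) ^ (-net.alpha τ))
      (fun τ => ?_) _
    have hg := measurable_gain (net := net) τ (.inl j)
    fun_prop
  · have hg := measurable_gain (net := net) .A (.inr i)
    simp only [interfPower]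
    fun_prop

lemma measurableSet_servedBy (ν : Tier) (x : ℕ ⊕ Fin net.N) :
    MeasurableSet (servedBy net ν x) := by
  have : servedBy net ν x = (⋂ y, ⋂ (_ : y ≠ x), {c : Config net | c.avgPower y < c.avgPower x}) ∩
      {c | c.tier x = ν} := by
    ext c
    simp [servedBy]
  rw [this]
  refine MeasurableSet.inter ?_ (measurableSet_tier_eq x ν)
  refine MeasurableSet.iInter fun y => MeasurableSet.iInter fun _ =>
    measurableSet_lt (measurable_avgPower y) (measurable_avgPower x)

lemma measurable_interf (pol : Policy) (ν : Tier) (x : ℕ ⊕ Fin net.N) :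
    Measurable (interf (net := net) pol ν x) := by
  have h : ∀ τ, Measurable (tierInterf (net := net) τ x) := by
    intro τ
    refine Measurable.tsum fun y => ?_
    refine Measurable.ite ?_ (measurable_interfPower y).ennreal_ofReal measurable_const
    exact (MeasurableSet.const _).inter (measurableSet_tier_eq y τ)
  have hL := h .L
  have hN := h .N
  have hA := h .A
  rcases pol <;> rcases ν
  all_goals first
    | exact (hL.add hN).add hA
    | exact hL.add hN
    | exact hA

end Config

end VHetNet

/-! ### Marks whose joint law is a product -/

section ProductLaw

variable {Ω α β γ : Type*} [MeasurableSpace Ω] [MeasurableSpace α] [MeasurableSpace β]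
  [MeasurableSpace γ] {P : Measure Ω} {T : Ω → α × β × γ}
  {a : Measure α} {b : Measure β} {c : Measure γ}
  [IsProbabilityMeasure b] [IsProbabilityMeasure c]

lemma map_fst_of_map_eq_prod (hT : Measurable T) (h : P.map T = a.prod (b.prod c)) :
    P.map (fun ω => (T ω).1) = a := by
  have : P.map (fun ω => (T ω).1) = (P.map T).map Prod.fst :=
    (Measure.map_map measurable_fst hT).symm
  rw [this, h, Measure.map_fst_prod, measure_univ, one_smul]

lemma map_snd_of_map_eq_prod [IsProbabilityMeasure a] (hT : Measurable T)
    (h : P.map T = a.prod (b.prod c)) :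
    P.map (fun ω => (T ω).2) = b.prod c := by
  have : P.map (fun ω => (T ω).2) = (P.map T).map Prod.snd :=
    (Measure.map_map measurable_snd hT).symm
  rw [this, h, Measure.map_snd_prod, measure_univ, one_smul]

lemma map_snd_fst_of_map_eq_prod [IsProbabilityMeasure a] (hT : Measurable T)
    (h : P.map T = a.prod (b.prod c)) :
    P.map (fun ω => (T ω).2.1) = b := by
  have : P.map (fun ω => (T ω).2.1) = (P.map fun ω => (T ω).2).map Prod.fst :=
    (Measure.map_map measurable_fst (by fun_prop)).symm
  rw [this, map_snd_of_map_eq_prod hT h, Measure.map_fst_prod, measure_univ, one_smul]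

lemma map_snd_snd_of_map_eq_prod [IsProbabilityMeasure a] (hT : Measurable T)
    (h : P.map T = a.prod (b.prod c)) :
    P.map (fun ω => (T ω).2.2) = c := by
  have : P.map (fun ω => (T ω).2.2) = (P.map fun ω => (T ω).2).map Prod.snd :=
    (Measure.map_map measurable_snd (by fun_prop)).symm
  rw [this, map_snd_of_map_eq_prod hT h, Measure.map_snd_prod, measure_univ, one_smul]

lemma indepFun_snd_fst_of_map_eq_prod [IsProbabilityMeasure P] [IsProbabilityMeasure a]
    (hT : Measurable T) (h : P.map T = a.prod (b.prod c)) :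
    IndepFun (fun ω => (T ω).2) (fun ω => (T ω).1) P := by
  refine IndepFun.symm ?_
  rw [indepFun_iff_map_prod_eq_prod_map_map (by fun_prop) (by fun_prop),
    map_fst_of_map_eq_prod hT h, map_snd_of_map_eq_prod hT h]
  exact h

end ProductLaw

/-! ### The random network -/

namespace VHetNet

variable {net : VHetNet}

lemma mu_pos (ν : Tier) : 0 < net.mu ν := by
  rcases ν
  · exact mul_pos (mul_pos net.PT_pos (net.eta_pos _)) net.gsT_pos
  · exact mul_pos (mul_pos net.PT_pos (net.eta_pos _)) net.gsT_pos
  · exact mul_pos (mul_pos net.PA_pos net.GmA_pos) (net.eta_pos _)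

lemma hUT_pos : 0 < net.hUT := sub_pos.2 net.hT_lt_hU

lemma hUA_pos : 0 < net.hUA := sub_pos.2 net.hU_lt_hA

instance : IsProbabilityMeasure net.gainLaw := by
  have h0 : 0 ≤ net.qA := div_nonneg net.thetaB_mem.1 (by norm_num)
  have h1 : net.qA ≤ 1 := (div_le_one (by norm_num)).2 net.thetaB_mem.2
  constructor
  simp only [gainLaw, Measure.add_apply, Measure.smul_apply, measure_univ, smul_eq_mul, mul_one]
  rw [← ENNReal.ofReal_add h0 (by linarith)]
  simp

instance (ν : Tier) : IsProbabilityMeasure (gammaMeasure (net.m ν) (net.m ν)) :=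
  isProbabilityMeasure_gammaMeasure (net.m_pos ν) (net.m_pos ν)

instance : IsProbabilityMeasure
    (ProbabilityTheory.cond (volume : Measure Plane) (Metric.closedBall 0 net.rD)) :=
  cond_isProbabilityMeasure_of_finite
    (Metric.measure_closedBall_pos volume 0 net.rD_pos).ne' measure_closedBall_lt_top.ne

instance : IsProbabilityMeasure ((volume : Measure ℝ).restrict (Icc 0 1)) := ⟨by simp⟩

namespace Model

variable {Ω : Type*} [MeasurableSpace Ω] {P : Measure Ω} (M : net.Model P)

/-- The random configuration of the network. -/
def config (ω : Ω) : Config net :=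
  (fun j => M.X j ω, fun j => (M.U j ω, M.HL j ω, M.HN j ω), fun i => (M.Y i ω, M.G i ω, M.HA i ω))

lemma measurable_positions : Measurable fun ω j => M.X j ω :=
  measurable_pi_lambda _ M.poisson.measurable

lemma measurable_terr_mark (j : ℕ) : Measurable fun ω => (M.U j ω, M.HL j ω, M.HN j ω) :=
  (M.measurable_U j).prodMk ((M.measurable_HL j).prodMk (M.measurable_HN j))

lemma measurable_aer_mark (i : Fin net.N) : Measurable fun ω => (M.Y i ω, M.G i ω, M.HA i ω) :=
  (M.measurable_Y i).prodMk ((M.measurable_G i).prodMk (M.measurable_HA i))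

lemma measurable_config : Measurable M.config :=
  M.measurable_positions.prodMk ((measurable_pi_lambda _ M.measurable_terr_mark).prodMk
    (measurable_pi_lambda _ M.measurable_aer_mark))

lemma tier_config (ω : Ω) (x : ℕ ⊕ Fin net.N) : (M.config ω).tier x = M.tier ω x := by
  rcases x with j | i <;> rfl

lemma dist_config (ω : Ω) (x : ℕ ⊕ Fin net.N) : (M.config ω).dist x = M.dist ω x := by
  rcases x with j | i <;> rfl

lemma gain_config (ω : Ω) (x : ℕ ⊕ Fin net.N) :
    (M.config ω).gain (M.tier ω x) x = M.fading ω x := by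
  rcases x with j | i
  · simp only [fading]
    rcases M.tier ω (.inl j) <;> rfl
  · rfl

lemma avgPower_config (ω : Ω) (x : ℕ ⊕ Fin net.N) : (M.config ω).avgPower x = M.avgPower ω x := by
  simp only [Config.avgPower, tier_config, dist_config, avgPower]

lemma interfPower_config (ω : Ω) (x : ℕ ⊕ Fin net.N) :
    (M.config ω).interfPower x = M.interfPower ω x := by
  rcases x with j | i
  · simp only [Config.interfPower, tier_config, dist_config, gain_config, interfPower]
  · rfl

/-- The strict inequalities in `IsServing` make the serving BS unique. -/
lemma serving_eq {ω : Ω} {x : ℕ ⊕ Fin net.N} (h : M.IsServing ω x) : M.serving ω = x := by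
  have hs : M.IsServing ω (M.serving ω) := Classical.epsilon_spec ⟨x, h⟩
  by_contra hne
  exact lt_asymm (h _ hne) (hs _ (Ne.symm hne))

lemma config_mem_servedBy {ν : Tier} {ω : Ω} {x : ℕ ⊕ Fin net.N} :
    M.config ω ∈ Config.servedBy net ν x ↔ M.IsServing ω x ∧ M.tier ω x = ν := by
  simp only [Config.servedBy, mem_ofPred_eq, avgPower_config, tier_config, IsServing]

lemma assoc_eq_iUnion (ν : Tier) :
    M.assoc ν = ⋃ x, M.config ⁻¹' Config.servedBy net ν x := by
  ext ω
  simp only [mem_iUnion, mem_preimage, config_mem_servedBy, assoc, mem_ofPred_eq]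
  refine ⟨fun h => ⟨_, h⟩, ?_⟩
  rintro ⟨x, h⟩
  rwa [M.serving_eq h.1]

lemma pairwise_disjoint_servedBy (ν : Tier) :
    Pairwise (Function.onFun Disjoint fun x => M.config ⁻¹' Config.servedBy net ν x) := by
  intro x y hxy
  refine disjoint_left.2 fun ω hx hy => hxy ?_
  rw [← M.serving_eq (M.config_mem_servedBy.1 hx).1, M.serving_eq (M.config_mem_servedBy.1 hy).1]

lemma servDist_eq {ν : Tier} {ω : Ω} {x : ℕ ⊕ Fin net.N}
    (h : M.config ω ∈ Config.servedBy net ν x) : M.servDist ω = (M.config ω).dist x := by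
  rw [servDist, M.serving_eq (M.config_mem_servedBy.1 h).1, dist_config]

lemma fading_serving_eq {ν : Tier} {ω : Ω} {x : ℕ ⊕ Fin net.N}
    (h : M.config ω ∈ Config.servedBy net ν x) :
    M.fading ω (M.serving ω) = (M.config ω).gain ν x := by
  have h' := M.config_mem_servedBy.1 h
  rw [M.serving_eq h'.1, ← h'.2, gain_config]

lemma interf_eq (pol : Policy) {ν : Tier} {ω : Ω} {x : ℕ ⊕ Fin net.N}
    (h : M.config ω ∈ Config.servedBy net ν x) :
    M.interf pol ω = Config.interf pol ν x (M.config ω) := by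
  have h' := M.config_mem_servedBy.1 h
  have hτ : ∀ τ, M.tierInterf τ ω = Config.tierInterf τ x (M.config ω) := by
    intro τ
    have hs := tsum_subtype {y | y ≠ M.serving ω ∧ M.tier ω y = τ}
      (fun y => ENNReal.ofReal (M.interfPower ω y))
    refine hs.trans ?_
    unfold Config.tierInterf
    congr 1
    funext y
    rw [interfPower_config, tier_config, M.serving_eq h'.1]
    by_cases hy : y ≠ x ∧ M.tier ω y = τ
    · rw [if_pos hy, indicator_of_mem (show y ∈ {y | y ≠ x ∧ M.tier ω y = τ} from hy)]
    · rw [if_neg hy, indicator_of_notMem (show y ∉ {y | y ≠ x ∧ M.tier ω y = τ} from hy)]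
  unfold interf Config.interf
  rw [M.serving_eq h'.1, h'.2]
  rcases pol <;> rcases ν <;> simp only [hτ]

/-! ### Independence of the fading of the serving BS -/

section Independence

/-- If `x` can belong to tier `ν`, the fading gain that it then has is Gamma distributed. -/
lemma map_gain [IsProbabilityMeasure P] {ν : Tier} {x : ℕ ⊕ Fin net.N} (hx : ν = .A ↔ x.isRight) :
    P.map (fun ω => (M.config ω).gain ν x) = gammaMeasure (net.m ν) (net.m ν) := by
  rcases x with j | i
  · rcases ν
    · exact map_snd_fst_of_map_eq_prod (M.measurable_terr_mark j) (M.law_terr j)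
    · exact map_snd_snd_of_map_eq_prod (M.measurable_terr_mark j) (M.law_terr j)
    · simp at hx
  · obtain rfl : ν = .A := hx.2 rfl
    exact map_snd_snd_of_map_eq_prod (M.measurable_aer_mark i) (M.law_aer i)

/-- The fading gain of `x` is independent of all of the configuration but the erased gains. -/
lemma indepFun_gain_erase [IsProbabilityMeasure P] (ν : Tier) (x : ℕ ⊕ Fin net.N) :
    IndepFun (fun ω => (M.config ω).gain ν x) (fun ω => Config.erase x (M.config ω)) P := by
  have hT : Measurable fun ω j => (M.U j ω, M.HL j ω, M.HN j ω) :=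
    measurable_pi_lambda _ M.measurable_terr_mark
  have hZ : Measurable fun ω i => (M.Y i ω, M.G i ω, M.HA i ω) :=
    measurable_pi_lambda _ M.measurable_aer_mark
  have hX := M.measurable_positions
  rcases x with j | i
  · obtain ⟨g, hg, hgain⟩ : ∃ g : ℝ × ℝ → ℝ, Measurable g ∧
        ∀ c : Config net, c.gain ν (.inl j) = g (c.2.1 j).2 := by
      rcases ν
      · exact ⟨Prod.fst, measurable_fst, fun _ => rfl⟩
      · exact ⟨Prod.snd, measurable_snd, fun _ => rfl⟩
      · exact ⟨Prod.snd, measurable_snd, fun _ => rfl⟩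
    simp only [hgain]
    have hup : Measurable fun t : ℕ → ℝ × ℝ × ℝ =>
        Function.update t j ((t j).1, (0 : ℝ), (0 : ℝ)) :=
      measurable_update' (a := j) |>.comp
        (f := fun t : ℕ → ℝ × ℝ × ℝ => (t, ((t j).1, (0 : ℝ), (0 : ℝ)))) (by fun_prop)
    -- Add to the erased marks the positions, then the aerial BSs.
    have h0 := M.indep_terr.indepFun_update M.measurable_terr_mark j
      (g := fun t => g t.2) (e := fun t => (t.1, (0 : ℝ), (0 : ℝ)))
      (by fun_prop) (by fun_prop)
      ((indepFun_snd_fst_of_map_eq_prod (M.measurable_terr_mark j) (M.law_terr j)).comp hg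
        (show Measurable fun u : ℝ => (u, (0 : ℝ), (0 : ℝ)) by fun_prop))
    have hgm : Measurable fun ω => g (M.HL j ω, M.HN j ω) :=
      hg.comp ((M.measurable_HL j).prodMk (M.measurable_HN j))
    have h1 := IndepFun.prodMk_of_prodMk hgm (hup.comp hT) hX h0
      (M.indep_marks.symm.comp
        (show Measurable fun t : ℕ → ℝ × ℝ × ℝ => (g (t j).2,
          Function.update t j ((t j).1, (0 : ℝ), (0 : ℝ))) from
          (hg.comp (by fun_prop)).prodMk hup) measurable_id)
    have h2 := IndepFun.prodMk_of_prodMk hgm ((hup.comp hT).prodMk hX) hZ h1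
      (M.indep_tiers.comp
        (show Measurable fun p : (ℕ → Plane) × (ℕ → ℝ × ℝ × ℝ) => (g (p.2 j).2,
          (Function.update p.2 j ((p.2 j).1, (0 : ℝ), (0 : ℝ)), p.1)) from
          (hg.comp (by fun_prop)).prodMk ((hup.comp measurable_snd).prodMk measurable_fst))
        measurable_id)
    exact h2.comp measurable_id
      (show Measurable fun q : ((ℕ → ℝ × ℝ × ℝ) × (ℕ → Plane)) × (Fin net.N → Plane × ℝ × ℝ) =>
        ((q.1.2, q.1.1, q.2) : Config net) by fun_prop)
  · have hup : Measurable fun t : Fin net.N → Plane × ℝ × ℝ =>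
        Function.update t i ((t i).1, (0 : ℝ), (0 : ℝ)) :=
      measurable_update' (a := i) |>.comp
        (f := fun t : Fin net.N → Plane × ℝ × ℝ => (t, ((t i).1, (0 : ℝ), (0 : ℝ))))
        (by fun_prop)
    have h0 := M.indep_aer.indepFun_update M.measurable_aer_mark i
      (g := fun t => t.2.2) (e := fun t => (t.1, (0 : ℝ), (0 : ℝ)))
      (by fun_prop) (by fun_prop)
      ((indepFun_snd_fst_of_map_eq_prod (M.measurable_aer_mark i) (M.law_aer i)).comp measurable_snd
        (show Measurable fun u : Plane => (u, (0 : ℝ), (0 : ℝ)) by fun_prop))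
    have h1 := IndepFun.prodMk_of_prodMk (M.measurable_HA i) (hup.comp hZ) (hX.prodMk hT) h0
      (M.indep_tiers.symm.comp
        (show Measurable fun t : Fin net.N → Plane × ℝ × ℝ => ((t i).2.2,
          Function.update t i ((t i).1, (0 : ℝ), (0 : ℝ))) from
          Measurable.prodMk (by fun_prop) hup) measurable_id)
    exact h1.comp measurable_id
      (show Measurable fun q : (Fin net.N → Plane × ℝ × ℝ) × ((ℕ → Plane) × (ℕ → ℝ × ℝ × ℝ)) =>
        ((q.2.1, q.2.2, q.1) : Config net) by fun_prop)

lemma aemeasurable_servDist (ν : Tier) :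
    AEMeasurable M.servDist (ProbabilityTheory.cond P (M.assoc ν)) := by
  rw [assoc_eq_iUnion]
  exact aemeasurable_cond_iUnion
    (fun x => M.measurable_config (Config.measurableSet_servedBy ν x))
    (fun x => (Config.measurable_dist x).comp M.measurable_config) fun x ω h => M.servDist_eq h

lemma aemeasurable_interf (pol : Policy) (ν : Tier) :
    AEMeasurable (M.interf pol) (ProbabilityTheory.cond P (M.assoc ν)) := by
  rw [assoc_eq_iUnion]
  exact aemeasurable_cond_iUnion
    (fun x => M.measurable_config (Config.measurableSet_servedBy ν x))
    (fun x => (Config.measurable_interf pol ν x).comp M.measurable_config)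
    fun x ω h => M.interf_eq pol h

lemma aemeasurable_fading_serving (ν : Tier) :
    AEMeasurable (fun ω => M.fading ω (M.serving ω)) (ProbabilityTheory.cond P (M.assoc ν)) := by
  rw [assoc_eq_iUnion]
  exact aemeasurable_cond_iUnion
    (fun x => M.measurable_config (Config.measurableSet_servedBy ν x))
    (fun x => (Config.measurable_gain ν x).comp M.measurable_config)
    fun x ω h => M.fading_serving_eq h

/-- Conditionally on the tier of the serving BS, its fading gain is Gamma distributed and
independent of its distance and of the interference. -/
lemma map_servDist_interf_fading [IsProbabilityMeasure P] (pol : Policy) (ν : Tier) :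
    (ProbabilityTheory.cond P (M.assoc ν)).map
        (fun ω => ((M.servDist ω, M.interf pol ω), M.fading ω (M.serving ω))) =
      ((ProbabilityTheory.cond P (M.assoc ν)).map fun ω => (M.servDist ω, M.interf pol ω)).prod
        (gammaMeasure (net.m ν) (net.m ν)) := by
  have hW : ∀ x : ℕ ⊕ Fin net.N,
      Measurable fun c : Config net => (c.dist x, Config.interf pol ν x c) :=
    fun x => (Config.measurable_dist x).prodMk (Config.measurable_interf pol ν x)
  rw [assoc_eq_iUnion]
  refine map_cond_iUnion_eq_prod
    (fun x => M.measurable_config (Config.measurableSet_servedBy ν x))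
    (M.pairwise_disjoint_servedBy ν) (fun x => (hW x).comp M.measurable_config)
    (fun x ω h => Prod.ext (M.servDist_eq h) (M.interf_eq pol h))
    (fun x => (Config.measurable_gain ν x).comp M.measurable_config)
    (fun x ω h => M.fading_serving_eq h) fun x B C hB hC => ?_
  by_cases hx : ν = .A ↔ x.isRight
  · -- The event, the distance and the interference do not see the erased gains.
    have hA : M.config ⁻¹' Config.servedBy net ν x ∩
        ((fun c : Config net => (c.dist x, Config.interf pol ν x c)) ∘ M.config) ⁻¹' B =
        (fun ω => Config.erase x (M.config ω)) ⁻¹' (Config.servedBy net ν x ∩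
          (fun c : Config net => (c.dist x, Config.interf pol ν x c)) ⁻¹' B) := by
      ext ω
      simp only [mem_inter_iff, mem_preimage, Function.comp_apply, Config.erase_mem_servedBy,
        Config.dist_erase, Config.interf_erase]
    have hC' : ((fun c : Config net => c.gain ν x) ∘ M.config) ⁻¹' C =
        (fun ω => (M.config ω).gain ν x) ⁻¹' C := rfl
    rw [← inter_assoc, hA, hC', inter_comm,
      (M.indepFun_gain_erase ν x).measure_inter_preimage_eq_mul
      _ _ hC ((Config.measurableSet_servedBy ν x).inter (hW x hB)), ← M.map_gain hx,
      Measure.map_apply (show Measurable fun ω => (M.config ω).gain ν x from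
        (Config.measurable_gain ν x).comp M.measurable_config) hC, mul_comm]
  · -- Such a BS cannot belong to tier `ν`.
    have hempty : M.config ⁻¹' Config.servedBy net ν x = ∅ := by
      refine eq_empty_of_forall_notMem fun ω hω => hx ?_
      have ht := (M.config_mem_servedBy.1 hω).2
      rw [← ht]
      rcases x with j | i
      · simp only [tier]
        split_ifs <;> simp
      · simp [tier]
    simp [hempty]

end Independence

/-! ### The law of the serving distance -/

section Distance

/-- The positions of a Poisson process are absolutely continuous: a null set contains no point. -/
lemma X_notMem_of_volume_eq_zero [IsProbabilityMeasure P] {B : Set Plane} (hB : MeasurableSet B)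
    (hB0 : volume B = 0) (j : ℕ) : P (M.X j ⁻¹' B) = 0 := by
  have h0 : (ENNReal.ofReal net.lam • (volume : Measure Plane)) B = 0 := by simp [hB0]
  have h := M.poisson.poisson B hB (by simp [h0]) 0
  rw [h0] at h
  have hset : {ω | pointCount M.X B ω = (0 : ℕ)} = (⋃ j, M.X j ⁻¹' B)ᶜ := by
    ext ω
    simp [pointCount, Set.eq_empty_iff_forall_notMem]
  have hm : MeasurableSet (⋃ j, M.X j ⁻¹' B) :=
    MeasurableSet.iUnion fun j => M.poisson.measurable j hB
  rw [hset] at h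
  have h1 : P (⋃ j, M.X j ⁻¹' B)ᶜ = 1 := by simpa using h
  exact measure_mono_null (subset_iUnion (fun j => M.X j ⁻¹' B) j) ((prob_compl_eq_one_iff hm).1 h1)

lemma map_Y [IsProbabilityMeasure P] (i : Fin net.N) : P.map (M.Y i) =
    ProbabilityTheory.cond (volume : Measure Plane) (Metric.closedBall 0 net.rD) :=
  map_fst_of_map_eq_prod (M.measurable_aer_mark i) (M.law_aer i)

/-- The distance of each single BS is absolutely continuous. -/
lemma measure_dist_preimage_eq_zero [IsProbabilityMeasure P] {B : Set ℝ} (hB : MeasurableSet B)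
    (hB0 : volume B = 0) (x : ℕ ⊕ Fin net.N) : P {ω | M.dist ω x ∈ B} = 0 := by
  rcases x with j | i
  · have hm : MeasurableSet {z : Plane | Real.sqrt (‖z‖ ^ 2 + net.hUT ^ 2) ∈ B} :=
      measurableSet_preimage (by fun_prop) hB
    exact M.X_notMem_of_volume_eq_zero hm (volume_preimage_dist_eq_zero hB hB0) j
  · have hm : MeasurableSet {z : Plane | Real.sqrt (‖z‖ ^ 2 + net.hUA ^ 2) ∈ B} :=
      measurableSet_preimage (by fun_prop) hB
    have h : P.map (M.Y i) {z : Plane | Real.sqrt (‖z‖ ^ 2 + net.hUA ^ 2) ∈ B} = 0 := by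
      rw [map_Y]
      exact cond_absolutelyContinuous (volume_preimage_dist_eq_zero hB hB0)
    rwa [Measure.map_apply (M.measurable_Y i) hm] at h

lemma servDist_preimage_null [IsProbabilityMeasure P] {B : Set ℝ} (hB : MeasurableSet B)
    (hB0 : volume B = 0) : P (M.servDist ⁻¹' B) = 0 := by
  have hnull : P (⋃ x, {ω | M.dist ω x ∈ B}) = 0 :=
    measure_iUnion_null fun x => M.measure_dist_preimage_eq_zero hB hB0 x
  have hsub : M.servDist ⁻¹' B ⊆ ⋃ x, {ω | M.dist ω x ∈ B} := by
    intro ω hω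
    rw [mem_preimage, servDist] at hω
    simp only [mem_iUnion, mem_ofPred_eq]
    exact ⟨M.serving ω, hω⟩
  exact measure_mono_null hsub hnull

lemma map_servDist_absolutelyContinuous [IsProbabilityMeasure P] (ν : Tier) :
    (ProbabilityTheory.cond P (M.assoc ν)).map M.servDist ≪ volume := by
  refine Measure.AbsolutelyContinuous.mk fun B hB hB0 => ?_
  rw [Measure.map_apply_of_aemeasurable (M.aemeasurable_servDist ν) hB]
  exact cond_absolutelyContinuous (M.servDist_preimage_null hB hB0)

lemma hasPDF_servDist [IsProbabilityMeasure P] (ν : Tier) :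
    HasPDF M.servDist (ProbabilityTheory.cond P (M.assoc ν)) volume where
  aemeasurable' := M.aemeasurable_servDist ν
  haveLebesgueDecomposition' := inferInstance
  absolutelyContinuous' := M.map_servDist_absolutelyContinuous ν

lemma ae_Y_mem_closedBall [IsProbabilityMeasure P] (i : Fin net.N) :
    ∀ᵐ ω ∂P, ‖M.Y i ω‖ ≤ net.rD := by
  have h : ∀ᵐ y ∂(P.map (M.Y i)), y ∈ Metric.closedBall (0 : Plane) net.rD := by
    rw [map_Y]
    exact ae_cond_mem Metric.isClosed_closedBall.measurableSet
  filter_upwards [ae_of_ae_map (M.measurable_Y i).aemeasurable h] with ω hω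
  simpa using hω

/-- A BS of tier `ν` at distance `r` that is received more strongly than an aerial BS at distance
`x ≤ d` is at distance at most `zetaA ν d`. -/
lemma le_zetaA {ν : Tier} {r x : ℝ} (hr : 0 < r) (hx : 0 < x) (hxd : x ≤ net.d)
    (h : net.mu .A * x ^ (-net.alpha .A) < net.mu ν * r ^ (-net.alpha ν)) :
    r ≤ net.zetaA ν net.d := by
  have hμ := mu_pos (net := net) ν
  have hμA := mu_pos (net := net) .A
  have hα := net.alpha_pos ν
  have hrα := Real.rpow_pos_of_pos hr (net.alpha ν)
  have hxα := Real.rpow_pos_of_pos hx (net.alpha .A)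
  rw [Real.rpow_neg hr.le, Real.rpow_neg hx.le, ← div_eq_mul_inv, ← div_eq_mul_inv,
    div_lt_div_iff₀ hxα hrα] at h
  have h1 : r ^ net.alpha ν ≤ net.mu ν * net.d ^ net.alpha .A / net.mu .A := by
    rw [le_div_iff₀ hμA, mul_comm]
    refine h.le.trans ?_
    have := Real.rpow_le_rpow hx.le hxd (net.alpha_pos .A).le
    gcongr
  calc r = (r ^ net.alpha ν) ^ (1 / net.alpha ν) := by
        rw [← Real.rpow_mul hr.le, mul_one_div_cancel hα.ne', Real.rpow_one]
    _ ≤ _ := Real.rpow_le_rpow hrα.le h1 (by positivity)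

lemma le_dist_inl (ω : Ω) (j : ℕ) : net.hUT ≤ M.dist ω (.inl j) :=
  Real.le_sqrt_of_sq_le (by nlinarith [sq_nonneg ‖M.X j ω‖])

lemma le_dist_inr (ω : Ω) (i : Fin net.N) : net.hUA ≤ M.dist ω (.inr i) :=
  Real.le_sqrt_of_sq_le (by nlinarith [sq_nonneg ‖M.Y i ω‖])

lemma dist_inr_le {ω : Ω} {i : Fin net.N} (h : ‖M.Y i ω‖ ≤ net.rD) : M.dist ω (.inr i) ≤ net.d :=
  Real.sqrt_le_sqrt (by gcongr)

/-- A terrestrial BS serves only if it beats every aerial BS, and these are at distance at most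
`d`; this bounds its distance. -/
lemma ae_servDist_mem_distRange [IsProbabilityMeasure P] (ν : Tier) :
    ∀ᵐ ω ∂(ProbabilityTheory.cond P (M.assoc ν)), M.servDist ω ∈ net.distRange ν := by
  have hE : MeasurableSet (M.assoc ν) := by
    rw [assoc_eq_iUnion]
    exact MeasurableSet.iUnion fun x => M.measurable_config (Config.measurableSet_servedBy ν x)
  have hY : ∀ᵐ ω ∂(ProbabilityTheory.cond P (M.assoc ν)), ∀ i, ‖M.Y i ω‖ ≤ net.rD :=
    cond_absolutelyContinuous.ae_le (ae_all_iff.2 M.ae_Y_mem_closedBall)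
  filter_upwards [ae_cond_mem hE, hY] with ω hω hYω
  obtain ⟨hs, ht⟩ := hω
  have hterr : ∀ j, M.serving ω = .inl j → M.servDist ω ∈ Icc net.hUT (net.zetaA ν net.d) := by
    intro j hj
    have hp := hs (.inr ⟨0, net.N_pos⟩) (by rw [hj]; simp)
    have hl : net.hUT ≤ M.servDist ω := by
      rw [servDist, hj]
      exact M.le_dist_inl ω j
    refine ⟨hl, le_zetaA (hUT_pos.trans_le hl) (hUA_pos.trans_le (M.le_dist_inr ω ⟨0, net.N_pos⟩))
      (M.dist_inr_le (hYω _)) ?_⟩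
    rw [avgPower, avgPower, ht] at hp
    exact hp
  rcases hsv : M.serving ω with j | i
  · have h := hterr j hsv
    rcases ν
    · exact h
    · exact h
    · rw [hsv, tier] at ht
      split_ifs at ht
  · rw [hsv, tier] at ht
    subst ht
    rw [servDist, hsv]
    exact ⟨M.le_dist_inr ω i, M.dist_inr_le (hYω i)⟩

end Distance

end Model

lemma measurableSet_distRange (ν : Tier) : MeasurableSet (net.distRange ν) := by
  rcases ν <;> exact measurableSet_Icc

lemma exists_distRange_subset_Ici (ν : Tier) : ∃ h₀ > 0, net.distRange ν ⊆ Ici h₀ := by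
  rcases ν
  · exact ⟨net.hUT, hUT_pos, Icc_subset_Ici_self⟩
  · exact ⟨net.hUT, hUT_pos, Icc_subset_Ici_self⟩
  · exact ⟨net.hUA, hUA_pos, Icc_subset_Ici_self⟩

end VHetNet

/-! ### The average achievable rate -/

theorem theorem2 {Ω : Type*} [MeasurableSpace Ω] (P : Measure Ω) [IsProbabilityMeasure P]
    (net : VHetNet) (M : net.Model P) (pol : Policy) (ν : Tier)
    (mν : ℕ) (hm : net.m ν = mν) (hE : P (M.assoc ν) ≠ 0) :
    HasPDF M.servDist (ProbabilityTheory.cond P (M.assoc ν)) volume ∧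
    Integrable (fun ω => Real.logb 2 (1 + M.sinr pol ω))
      (ProbabilityTheory.cond P (M.assoc ν)) ∧
    (∀ r, ContDiffOn ℝ (⊤ : ℕ∞) (M.laplaceV pol ν r) (Set.Ioi 0)) ∧
    ∀ S : Set ℝ, MeasurableSet S → net.distRange ν ⊆ S →
      (∀ k < mν, IntegrableOn
        (fun p : ℝ × ℝ => p.2 ^ (k * net.alpha ν) * (Real.exp p.1 - 1) ^ k *
          iteratedDeriv k (M.laplaceV pol ν p.2)
            (net.m ν * (Real.exp p.1 - 1) * p.2 ^ net.alpha ν / net.mu ν) *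
          M.servDistPdf ν p.2) (Set.Ioi 0 ×ˢ S)) ∧
      M.rate pol ν =
        ∑ k ∈ Finset.range mν, (-1) ^ k / (Real.log 2 * k !) * (net.m ν / net.mu ν) ^ k *
          ∫ t in Set.Ioi (0 : ℝ), ∫ r in S,
            r ^ (k * net.alpha ν) * (Real.exp t - 1) ^ k *
              iteratedDeriv k (M.laplaceV pol ν r)
                (net.m ν * (Real.exp t - 1) * r ^ net.alpha ν / net.mu ν) *
              M.servDistPdf ν r := by
  have hpdf := M.hasPDF_servDist ν
  have : IsProbabilityMeasure (ProbabilityTheory.cond P (M.assoc ν)) := cond_isProbabilityMeasure hE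
  have hn : mν ≠ 0 := by
    rintro rfl
    have := net.m_pos ν
    simp [hm] at this
  obtain ⟨h₀, h₀_pos, hsub⟩ := VHetNet.exists_distRange_subset_Ici (net := net) ν
  have hEm : MeasurableSet (M.assoc ν) := by
    rw [M.assoc_eq_iUnion]
    exact MeasurableSet.iUnion fun x =>
      M.measurable_config (VHetNet.Config.measurableSet_servedBy ν x)
  have hsinr : ∀ᵐ ω ∂(ProbabilityTheory.cond P (M.assoc ν)), M.sinr pol ω =
      sinrOf (net.mu ν) (net.alpha ν) net.noise (M.servDist ω) (M.interf pol ω)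
        (M.fading ω (M.serving ω)) := by
    filter_upwards [ae_cond_mem hEm] with ω hω
    rw [VHetNet.Model.sinr, VHetNet.Model.avgPower, hω.2]
    rfl
  obtain ⟨hint, hrate⟩ := rate_formula (M.aemeasurable_interf pol ν)
    (M.aemeasurable_fading_serving ν) hm hn (VHetNet.mu_pos ν) (net.alpha_pos ν) net.noise_pos
    (M.map_servDist_interf_fading pol ν) (VHetNet.measurableSet_distRange ν) h₀_pos hsub
    (M.ae_servDist_mem_distRange ν) hsinr
  exact ⟨hpdf, hint, fun r => contDiffOn_shiftedLaplace _ net.noise_pos.le, hrate⟩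

end
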